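/- Let $p$ be a prime number, let $R=\mathbb{Z}[X,Y]$, and let $T=\bigl(R/(XY-p)\bigr)_{(X,Y)}$ be the localization of $R/(XY-p)$ at the prime ideal generated by the classes of $X$ and $Y$. Let $J$ be an ideal of $T$, let $I=J\cap R$ be its inverse image under the canonical map $R\to T$, and let $i\ge 0$ be an integer. Suppose that the prime $p\mathbb{Z}$ of $\mathbb{Z}$ lies neither in $\operatorname{Ass}_{\mathbb{Z}} H^{i}_I(R)$ nor in $\operatorname{Ass}_{\mathbb{Z}} H^{i+1}_I(R)$, where $H^\bullet_I$ denotes local cohomology with support in $I$. Then the Bockstein homomorphism $$\beta^{i-1}_{p,IT}=\pi\circ\delta\colon\; H^{i-1}_{IT}(T/pT)\longrightarrow H^{i}_{IT}(T/pT)$$ is zero. Here $\delta\colon H^{i-1}_{IT}(T/pT)\to H^{i}_{IT}(T)$ is the connecting homomorphism of the short exact sequence $0\to T\xrightarrow{\;p\;}T\to T/pT\to 0$ (note that $p$ is a nonzerodivisor on $T$), the map $\pi\colon H^{i}_{IT}(T)\to H^{i}_{IT}(T/pT)$ is induced by the projection $T\to T/pT$, and $H^{-1}_{IT}=0$. -/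

import Mathlib

open CategoryTheory CategoryTheory.Limits

noncomputable section

universe u

/-! ### Connecting homomorphisms for left derived functors -/

namespace LeftDerivedConnecting

universe v₁ v₂ u₁ u₂

variable {C : Type u₁} [Category.{v₁} C] {D : Type u₂} [Category.{v₂} D] [Abelian C] [Abelian D]
  {F G H : C ⥤ D} [F.Additive] [G.Additive] [H.Additive]

/-- Applying `F ⟶ G ⟶ H` degreewise to a chain complex `K`. -/
def complexes (α : F ⟶ G) (β : G ⟶ H) (w : α ≫ β = 0) (K : ChainComplex C ℕ) :
    ShortComplex (ChainComplex D ℕ) where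
  X₁ := (F.mapHomologicalComplex _).obj K
  X₂ := (G.mapHomologicalComplex _).obj K
  X₃ := (H.mapHomologicalComplex _).obj K
  f := (NatTrans.mapHomologicalComplex α _).app K
  g := (NatTrans.mapHomologicalComplex β _).app K
  zero := by
    ext n
    exact congrArg (fun t : F ⟶ H => t.app (K.X n)) w

/-- The map of short complexes of chain complexes induced by a chain map. -/
def complexesMap (α : F ⟶ G) (β : G ⟶ H) (w : α ≫ β = 0) {K L : ChainComplex C ℕ} (φ : K ⟶ L) :
    complexes α β w K ⟶ complexes α β w L where
  τ₁ := (F.mapHomologicalComplex _).map φ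
  τ₂ := (G.mapHomologicalComplex _).map φ
  τ₃ := (H.mapHomologicalComplex _).map φ
  comm₁₂ := ((NatTrans.mapHomologicalComplex α (ComplexShape.down ℕ)).naturality φ)
  comm₂₃ := ((NatTrans.mapHomologicalComplex β (ComplexShape.down ℕ)).naturality φ)

/-- `F ⟶ G ⟶ H` is short exact on projective objects. -/
def ExactOnProjectives (α : F ⟶ G) (β : G ⟶ H) (w : α ≫ β = 0) : Prop :=
  ∀ (P : C) [Projective P],
    (ShortComplex.mk (α.app P) (β.app P)
      (congrArg (fun t : F ⟶ H => t.app P) w)).ShortExact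

lemma complexes_shortExact {α : F ⟶ G} {β : G ⟶ H} {w : α ≫ β = 0}
    (h : ExactOnProjectives α β w) {X : C} (P : ProjectiveResolution X) :
    (complexes α β w P.complex).ShortExact :=
  HomologicalComplex.shortExact_of_degreewise_shortExact _ fun n =>
    h (P.complex.X n)

/-- The homology boundary map computed on a projective resolution `P`. -/
def boundary {α : F ⟶ G} {β : G ⟶ H} {w : α ≫ β = 0} (h : ExactOnProjectives α β w)
    {X : C} (P : ProjectiveResolution X) (n : ℕ) :
    (HomologicalComplex.homologyFunctor D _ (n + 1)).obj
        ((H.mapHomologicalComplex (ComplexShape.down ℕ)).obj P.complex) ⟶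
      (HomologicalComplex.homologyFunctor D _ n).obj
        ((F.mapHomologicalComplex (ComplexShape.down ℕ)).obj P.complex) :=
  (complexes_shortExact h P).δ (n + 1) n (by simp)

lemma boundary_naturality {α : F ⟶ G} {β : G ⟶ H} {w : α ≫ β = 0}
    (h : ExactOnProjectives α β w) {X Y : C} (P : ProjectiveResolution X)
    (Q : ProjectiveResolution Y) (φ : P.complex ⟶ Q.complex) (n : ℕ) :
    (H.mapHomologicalComplex _ ⋙ HomologicalComplex.homologyFunctor D _ (n + 1)).map φ ≫
        boundary h Q n =
      boundary h P n ≫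
        (F.mapHomologicalComplex _ ⋙ HomologicalComplex.homologyFunctor D _ n).map φ :=
  (HomologicalComplex.HomologySequence.δ_naturality (complexesMap α β w φ)
    (complexes_shortExact h P) (complexes_shortExact h Q) (n + 1) n (by simp)).symm

variable [EnoughProjectives C]

/-- The connecting homomorphism `L_{n+1} H ⟶ L_n F`: the boundary map of the short exact sequence
of complexes obtained by applying `F ⟶ G ⟶ H` to a projective resolution. -/
def connecting {α : F ⟶ G} {β : G ⟶ H} {w : α ≫ β = 0}
    (h : ExactOnProjectives α β w) (n : ℕ) : H.leftDerived (n + 1) ⟶ F.leftDerived n where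
  app X :=
    ((projectiveResolution X).isoLeftDerivedObj H (n + 1)).hom ≫
      boundary h (projectiveResolution X) n ≫
      ((projectiveResolution X).isoLeftDerivedObj F n).inv
  naturality X Y f := by
    have comm := ProjectiveResolution.lift_commutes_zero f
      (projectiveResolution X) (projectiveResolution Y)
    have e1 := ProjectiveResolution.isoLeftDerivedObj_hom_naturality f _ _ _ comm H (n + 1)
    have e2 := ProjectiveResolution.isoLeftDerivedObj_inv_naturality f _ _ _ comm F n
    have e3 := boundary_naturality h _ _
      (ProjectiveResolution.lift f (projectiveResolution X) (projectiveResolution Y)) n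
    rw [reassoc_of% e1, Category.assoc, Category.assoc, e2, reassoc_of% e3]
    rfl

end LeftDerivedConnecting

/-! ### Connecting homomorphisms for Ext and local cohomology -/

section Connecting

variable {A : Type u} [CommRing A]

/-- The contravariant functor `Hom_A(-, M)`, as a covariant functor to the opposite category:
the functor whose left derived functors are `Ext`. -/
abbrev homInto (M : ModuleCat.{u} A) : ModuleCat.{u} A ⥤ (ModuleCat.{u} A)ᵒᵖ :=
  ((linearYoneda A (ModuleCat.{u} A)).obj M).rightOp

/-- Functoriality of `homInto` in the module. -/
abbrev homIntoMap {M N : ModuleCat.{u} A} (f : M ⟶ N) : homInto N ⟶ homInto M :=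
  NatTrans.rightOp ((linearYoneda A (ModuleCat.{u} A)).map f)

lemma homIntoMap_comp_eq_zero (S : ShortComplex (ModuleCat.{u} A)) :
    homIntoMap S.g ≫ homIntoMap S.f = 0 := by
  have h : (linearYoneda A (ModuleCat.{u} A)).map S.f ≫
      (linearYoneda A (ModuleCat.{u} A)).map S.g = 0 := by
    rw [← Functor.map_comp, S.zero]
    ext X f
    exact Limits.comp_zero (X := X.unop) (f := f)
  ext X
  exact congrArg (fun t => (t.app (Opposite.op X)).op) h

lemma homInto_exactOnProjectives {S : ShortComplex (ModuleCat.{u} A)} (hS : S.ShortExact) :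
    LeftDerivedConnecting.ExactOnProjectives (homIntoMap S.g) (homIntoMap S.f)
      (homIntoMap_comp_eq_zero S) := by
  intro P hP
  have hf : Mono S.f := hS.mono_f
  have hg : Epi S.g := hS.epi_g
  let S' : ShortComplex (ModuleCat.{u} A) :=
    ShortComplex.mk (((linearYoneda A (ModuleCat.{u} A)).map S.f).app (Opposite.op P))
      (((linearYoneda A (ModuleCat.{u} A)).map S.g).app (Opposite.op P)) (by
        rw [← NatTrans.comp_app, ← Functor.map_comp, S.zero]
        ext (f : P ⟶ S.X₁)
        exact Limits.comp_zero (f := f))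
  have hS' : S'.ShortExact := by
    refine ShortComplex.ShortExact.mk' ?_ ?_ ?_
    · rw [ShortComplex.moduleCat_exact_iff]
      intro (x : P ⟶ S.X₂) (hx : x ≫ S.g = 0)
      exact ⟨hS.exact.lift x hx, hS.exact.lift_f x hx⟩
    · rw [ModuleCat.mono_iff_injective]
      intro (x : P ⟶ S.X₁) (y : P ⟶ S.X₁) (hxy : x ≫ S.f = y ≫ S.f)
      exact (cancel_mono S.f).1 hxy
    · rw [ModuleCat.epi_iff_surjective]
      intro (x : P ⟶ S.X₃)
      exact ⟨Projective.factorThru x S.g, Projective.factorThru_comp x S.g⟩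
  exact hS'.op

/-- The connecting homomorphism `Ext^i(-, S.X₃) ⟶ Ext^{i+1}(-, S.X₁)` of a short exact sequence. -/
def extConnecting {S : ShortComplex (ModuleCat.{u} A)} (hS : S.ShortExact) (i : ℕ) :
    (Ext A (ModuleCat.{u} A) i).flip.obj S.X₃ ⟶ (Ext A (ModuleCat.{u} A) (i + 1)).flip.obj S.X₁ :=
  NatTrans.leftOp (LeftDerivedConnecting.connecting (homInto_exactOnProjectives hS) i)

/-- The connecting homomorphism `H^i_I(S.X₃) ⟶ H^{i+1}_I(S.X₁)` of a short exact sequence: the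
direct limit over `t` of the connecting homomorphisms
`Ext^i(A/I^t, S.X₃) ⟶ Ext^{i+1}(A/I^t, S.X₁)`. -/
def localCohomologyConnecting (I : Ideal A) {S : ShortComplex (ModuleCat.{u} A)}
    (hS : S.ShortExact) (i : ℕ) :
    (localCohomology I i).obj S.X₃ ⟶ (localCohomology I (i + 1)).obj S.X₁ :=
  (colimitObjIsoColimitCompEvaluation
      (localCohomology.diagram (localCohomology.idealPowersDiagram I) i) S.X₃).hom ≫
    colimMap (Functor.whiskerLeft
      (localCohomology.ringModIdeals (localCohomology.idealPowersDiagram I)).op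
      (extConnecting hS i)) ≫
    (colimitObjIsoColimitCompEvaluation
      (localCohomology.diagram (localCohomology.idealPowersDiagram I) (i + 1)) S.X₁).inv

/-! ### The Bockstein homomorphism -/

/-- The sequence `0 → A → A → A/uA → 0` given by multiplication by `u` and the projection. -/
def multiplicationSequence (u : A) : ShortComplex (ModuleCat.{u} A) where
  X₁ := ModuleCat.of A A
  X₂ := ModuleCat.of A A
  X₃ := ModuleCat.of A (A ⧸ Ideal.span {u})
  f := ModuleCat.ofHom (LinearMap.mulLeft A u)
  g := ModuleCat.ofHom (Submodule.mkQ (Ideal.span {u}))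
  zero := by
    rw [← ModuleCat.ofHom_comp]
    refine congrArg ModuleCat.ofHom (LinearMap.ext fun x => ?_)
    exact Ideal.Quotient.eq_zero_iff_mem.2
      (Ideal.mul_mem_right x _ (Ideal.mem_span_singleton_self u))

lemma multiplicationSequence_shortExact {u : A} (hu : u ∈ nonZeroDivisors A) :
    (multiplicationSequence u).ShortExact := by
  refine ShortComplex.ShortExact.mk' ?_ ?_ ?_
  · rw [ShortComplex.moduleCat_exact_iff]
    intro (x : A) (hx : Ideal.Quotient.mk (Ideal.span {u}) x = 0)
    obtain ⟨y, hy⟩ := Ideal.mem_span_singleton.1 (Ideal.Quotient.eq_zero_iff_mem.1 hx)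
    exact ⟨y, hy.symm⟩
  · rw [ModuleCat.mono_iff_injective]
    intro (x : A) (y : A) (hxy : u * x = u * y)
    exact (mul_cancel_left_mem_nonZeroDivisors hu).1 hxy
  · rw [ModuleCat.epi_iff_surjective]
    exact Ideal.Quotient.mk_surjective (I := Ideal.span {u})

/-- The functor `H^{i-1}_I`, with the convention `H^{-1}_I = 0`. -/
def predLocalCohomology (I : Ideal A) : ℕ → (ModuleCat.{u} A ⥤ ModuleCat.{u} A)
  | 0 => (Functor.const _).obj (ModuleCat.of A PUnit)
  | i + 1 => localCohomology I i

/-- The Bockstein homomorphism `H^{i-1}_I(A/uA) ⟶ H^i_I(A/uA)`: the connecting homomorphism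
`H^{i-1}_I(A/uA) ⟶ H^i_I(A)` of `0 → A → A → A/uA → 0` followed by the map
`H^i_I(A) ⟶ H^i_I(A/uA)` induced by the projection. -/
def bockstein (I : Ideal A) {u : A} (hu : u ∈ nonZeroDivisors A) : (i : ℕ) →
    ((predLocalCohomology I i).obj (ModuleCat.of A (A ⧸ Ideal.span {u})) ⟶
      (localCohomology I i).obj (ModuleCat.of A (A ⧸ Ideal.span {u})))
  | 0 => 0
  | i + 1 =>
    localCohomologyConnecting I (multiplicationSequence_shortExact hu) i ≫
      (localCohomology I (i + 1)).map (multiplicationSequence u).g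

end Connecting

/-! ### The rings -/

/-- The polynomial ring `ℤ[X, Y]`. -/
abbrev PolyXY : Type := MvPolynomial (Fin 2) ℤ

/-- The polynomial `XY - p`. -/
def xySubP (p : ℕ) : PolyXY := MvPolynomial.X 0 * MvPolynomial.X 1 - (p : PolyXY)

/-- The ring `ℤ[X, Y]/(XY - p)`. -/
abbrev QuotXY (p : ℕ) : Type := PolyXY ⧸ Ideal.span {xySubP p}

/-- The ideal `(X, Y)` of `ℤ[X, Y]/(XY - p)`. -/
def idealXY (p : ℕ) : Ideal (QuotXY p) :=
  Ideal.span {Ideal.Quotient.mk _ (MvPolynomial.X 0), Ideal.Quotient.mk _ (MvPolynomial.X 1)}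

/-- Reduction modulo `(X, Y)`. -/
def residueMap (p : ℕ) : QuotXY p →+* ZMod p :=
  Ideal.Quotient.lift _ (MvPolynomial.eval₂Hom (Int.castRingHom (ZMod p)) 0) (by
    intro a ha
    obtain ⟨b, rfl⟩ := Ideal.mem_span_singleton.1 ha
    simp [xySubP])

lemma ker_residueMap (p : ℕ) : RingHom.ker (residueMap p) = idealXY p := by
  apply le_antisymm
  · intro a ha
    obtain ⟨g, rfl⟩ := Ideal.Quotient.mk_surjective a
    have hg : ((MvPolynomial.constantCoeff g : ℤ) : ZMod p) = 0 := by
      have h : MvPolynomial.eval₂ (Int.castRingHom (ZMod p)) 0 g = 0 := ha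
      rw [← h, MvPolynomial.eval₂_zero_apply]
      rfl
    have hx : Ideal.Quotient.mk (Ideal.span {xySubP p}) (MvPolynomial.X 0) ∈ idealXY p :=
      Ideal.subset_span (by simp)
    have hy : Ideal.Quotient.mk (Ideal.span {xySubP p}) (MvPolynomial.X 1) ∈ idealXY p :=
      Ideal.subset_span (by simp)
    have hpm : (p : QuotXY p) ∈ idealXY p := by
      have h : Ideal.Quotient.mk (Ideal.span {xySubP p}) (MvPolynomial.X 0) *
          Ideal.Quotient.mk (Ideal.span {xySubP p}) (MvPolynomial.X 1) = (p : QuotXY p) := by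
        rw [← map_mul, ← map_natCast (Ideal.Quotient.mk (Ideal.span {xySubP p})) p,
          Ideal.Quotient.eq]
        exact Ideal.mem_span_singleton_self _
      rw [← h]
      exact Ideal.mul_mem_right _ _ hx
    have key : ∀ q : PolyXY, Ideal.Quotient.mk (Ideal.span {xySubP p})
        (q - MvPolynomial.C (MvPolynomial.constantCoeff q)) ∈ idealXY p := by
      intro q
      induction q using MvPolynomial.induction_on with
      | C a => simp
      | add q r hq hr =>
        have := Ideal.add_mem _ hq hr
        rw [← map_add] at this
        convert this using 2
        simp only [map_add]
        ring
      | mul_X q n hq =>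
        simp only [map_mul, MvPolynomial.constantCoeff_X, mul_zero, map_zero, sub_zero]
        apply Ideal.mul_mem_left
        fin_cases n
        · exact hx
        · exact hy
    obtain ⟨c, hc⟩ := (ZMod.intCast_zmod_eq_zero_iff_dvd _ p).1 hg
    have h1 := key g
    rw [map_sub, hc] at h1
    have h2 : Ideal.Quotient.mk (Ideal.span {xySubP p}) (MvPolynomial.C ((p : ℤ) * c)) ∈
        idealXY p := by
      rw [map_mul, map_mul]
      apply Ideal.mul_mem_right
      simpa using hpm
    simpa using Ideal.add_mem _ h1 h2
  · rw [idealXY, Ideal.span_le]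
    rintro a (rfl | rfl) <;> simp [residueMap, RingHom.mem_ker]

instance idealXY_isPrime (p : ℕ) [Fact p.Prime] : (idealXY p).IsPrime := by
  rw [← ker_residueMap]
  exact RingHom.ker_isPrime _

/-- The ring `T = (ℤ[X, Y]/(XY - p))_{(X, Y)}`. -/
def LocXY (p : ℕ) [Fact p.Prime] : Type := Localization.AtPrime (idealXY p)

instance (p : ℕ) [Fact p.Prime] : CommRing (LocXY p) :=
  inferInstanceAs (CommRing (Localization.AtPrime (idealXY p)))

instance (p : ℕ) [Fact p.Prime] : Algebra (QuotXY p) (LocXY p) :=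
  inferInstanceAs (Algebra (QuotXY p) (Localization.AtPrime (idealXY p)))

instance (p : ℕ) [Fact p.Prime] : IsLocalization.AtPrime (LocXY p) (idealXY p) :=
  inferInstanceAs (IsLocalization.AtPrime (Localization.AtPrime (idealXY p)) (idealXY p))

/-- The canonical ring homomorphism `ℤ[X, Y] → T`. -/
def toLocXY (p : ℕ) [Fact p.Prime] : PolyXY →+* LocXY p :=
  (algebraMap (QuotXY p) (LocXY p)).comp (Ideal.Quotient.mk (Ideal.span {xySubP p}))

lemma natCast_mem_nonZeroDivisors_quotXY (p : ℕ) [hp : Fact p.Prime] :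
    (p : QuotXY p) ∈ nonZeroDivisors (QuotXY p) := by
  have hprime : Prime (MvPolynomial.C (p : ℤ) : PolyXY) :=
    (MvPolynomial.prime_C_iff _).2 (Nat.prime_iff_prime_int.1 hp.out)
  have hdvd : ∀ k : Fin 2, ¬ (MvPolynomial.C (p : ℤ) : PolyXY) ∣ MvPolynomial.X k := by
    intro k h
    rw [MvPolynomial.C_dvd_iff_dvd_coeff] at h
    have h1 := h (Finsupp.single k 1)
    rw [MvPolynomial.coeff_X, if_pos rfl] at h1
    exact (Nat.prime_iff_prime_int.1 hp.out).not_dvd_one h1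
  have hC : (p : PolyXY) = MvPolynomial.C (p : ℤ) := by simp
  rw [mem_nonZeroDivisors_iff_right]
  intro a ha
  obtain ⟨g, rfl⟩ := Ideal.Quotient.mk_surjective a
  rw [← map_natCast (Ideal.Quotient.mk (Ideal.span {xySubP p})) p, ← map_mul,
    Ideal.Quotient.eq_zero_iff_mem, Ideal.mem_span_singleton] at ha
  obtain ⟨h, hh⟩ := ha
  have hd : (MvPolynomial.C (p : ℤ) : PolyXY) ∣ MvPolynomial.X 0 * MvPolynomial.X 1 * h :=
    ⟨g + h, by rw [xySubP, hC] at hh; linear_combination -hh⟩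
  rcases hprime.dvd_or_dvd hd with hd | hd
  · rcases hprime.dvd_or_dvd hd with hd | hd
    · exact absurd hd (hdvd 0)
    · exact absurd hd (hdvd 1)
  · obtain ⟨k, rfl⟩ := hd
    rw [Ideal.Quotient.eq_zero_iff_mem, Ideal.mem_span_singleton]
    refine ⟨k, mul_left_cancel₀ hprime.ne_zero ?_⟩
    rw [hC] at hh
    linear_combination hh

lemma natCast_mem_nonZeroDivisors_locXY (p : ℕ) [Fact p.Prime] :
    (p : LocXY p) ∈ nonZeroDivisors (LocXY p) := by
  have h := IsLocalization.map_nonZeroDivisors_le (idealXY p).primeCompl (LocXY p)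
    (Submonoid.mem_map_of_mem (algebraMap (QuotXY p) (LocXY p))
      (natCast_mem_nonZeroDivisors_quotXY p))
  rwa [map_natCast] at h

end

/-! Write x, y for the images of X, Y in T. Since p = xy, there is an exact sequence 0 → T/y → T/p →
T/x → 0 (`productSequence`). The outer terms are one-dimensional domains with principal maximal
ideal, so the local cohomology of T/p vanishes in degrees ≥ 2
(`LocalCohomologyVanishes.quotient_add_two`), and the Bockstein has zero target for i ≥ 2. For i = 0
its source is zero.

There remains i = 1. If IT lies in both (x) and (y), the outer terms are killed by IT and H^1(T/p) =
0. If it lies in neither, H^0(T/p) = 0. The hypothesis on H^2_I(R) excludes the mixed case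
(`not_le_axisIdeal`): there I strictly contains (XY - p) and lies in some (X_k, p). Then I contains
a regular sequence of length two, so H^1_I(R) = 0; also H^0_I(R/p) = 0. Two connecting maps
therefore embed H^0_I(R/(p, X_k)) into the p-torsion of H^2_I(R), which is zero because p is not
associated. But I kills the nonzero class of 1 in R/(p, X_k), a contradiction.

Local cohomology is the colimit of Ext^i(A/J^t, -). Vanishing is tested on representatives
(`EventuallyZero`), so only the long exact sequence of Ext is needed. -/

noncomputable section

universe u

/-! ### The long exact sequence of left derived functors -/

namespace LeftDerivedConnecting

universe v₁ v₂ u₁ u₂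

variable {C : Type u₁} [Category.{v₁} C] {D : Type u₂} [Category.{v₂} D] [Abelian C] [Abelian D]
  {F G H : C ⥤ D} [F.Additive] [G.Additive] [H.Additive] [EnoughProjectives C]
  {α : F ⟶ G} {β : G ⟶ H} {w : α ≫ β = 0}

lemma connecting_comp (h : ExactOnProjectives α β w) (n : ℕ) (X : C) :
    (connecting h n).app X ≫ (NatTrans.leftDerived α n).app X = 0 := by
  rw [ProjectiveResolution.leftDerived_app_eq α (projectiveResolution X) n]
  have h0 : boundary h (projectiveResolution X) n ≫
      (HomologicalComplex.homologyFunctor D (ComplexShape.down ℕ) n).map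
        ((NatTrans.mapHomologicalComplex α _).app (projectiveResolution X).complex) = 0 :=
    (complexes_shortExact h (projectiveResolution X)).δ_comp (n + 1) n (by simp)
  simp only [connecting, Category.assoc, Iso.inv_hom_id_assoc]
  rw [reassoc_of% h0]
  simp

lemma comp_connecting (h : ExactOnProjectives α β w) (n : ℕ) (X : C) :
    (NatTrans.leftDerived β (n + 1)).app X ≫ (connecting h n).app X = 0 := by
  rw [ProjectiveResolution.leftDerived_app_eq β (projectiveResolution X) (n + 1)]
  have h0 : (HomologicalComplex.homologyFunctor D (ComplexShape.down ℕ) (n + 1)).map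
        ((NatTrans.mapHomologicalComplex β _).app (projectiveResolution X).complex) ≫
        boundary h (projectiveResolution X) n = 0 :=
    (complexes_shortExact h (projectiveResolution X)).comp_δ (n + 1) n (by simp)
  simp only [connecting, Category.assoc, Iso.inv_hom_id_assoc]
  rw [reassoc_of% h0]
  simp

lemma leftDerived_comp_eq_zero (w : α ≫ β = 0) (n : ℕ) (X : C) :
    (NatTrans.leftDerived α n).app X ≫ (NatTrans.leftDerived β n).app X = 0 := by
  rw [ProjectiveResolution.leftDerived_app_eq α (projectiveResolution X) n,
    ProjectiveResolution.leftDerived_app_eq β (projectiveResolution X) n]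
  simp only [Category.assoc, Iso.inv_hom_id_assoc]
  have h0 : (HomologicalComplex.homologyFunctor D (ComplexShape.down ℕ) n).map
        ((NatTrans.mapHomologicalComplex α _).app (projectiveResolution X).complex) ≫
      (HomologicalComplex.homologyFunctor D (ComplexShape.down ℕ) n).map
        ((NatTrans.mapHomologicalComplex β _).app (projectiveResolution X).complex) = 0 := by
    rw [← Functor.map_comp]
    have := (complexes α β w (projectiveResolution X).complex).zero
    change (HomologicalComplex.homologyFunctor D (ComplexShape.down ℕ) n).map
      ((complexes α β w (projectiveResolution X).complex).f ≫
      (complexes α β w (projectiveResolution X).complex).g) = 0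
    rw [this, Functor.map_zero]
  rw [reassoc_of% h0]
  simp

/-- This and the next two exactness statements are transported along `isoLeftDerivedObj` from the
homology sequence of one projective resolution. -/
lemma exact_connecting_left (h : ExactOnProjectives α β w) (n : ℕ) (X : C) :
    (ShortComplex.mk _ _ (connecting_comp h n X)).Exact := by
  let P := projectiveResolution X
  refine ShortComplex.exact_of_iso (ShortComplex.isoMk (P.isoLeftDerivedObj H (n + 1)).symm
    (P.isoLeftDerivedObj F n).symm (P.isoLeftDerivedObj G n).symm ?_ ?_)
    ((complexes_shortExact h P).homology_exact₁ (n + 1) n (by simp))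
  · exact Iso.inv_hom_id_assoc _ _
  · dsimp only
    rw [ProjectiveResolution.leftDerived_app_eq α P n]
    exact Iso.inv_hom_id_assoc _ _

lemma exact_connecting_right (h : ExactOnProjectives α β w) (n : ℕ) (X : C) :
    (ShortComplex.mk _ _ (comp_connecting h n X)).Exact := by
  let P := projectiveResolution X
  refine ShortComplex.exact_of_iso (ShortComplex.isoMk (P.isoLeftDerivedObj G (n + 1)).symm
    (P.isoLeftDerivedObj H (n + 1)).symm (P.isoLeftDerivedObj F n).symm ?_ ?_)
    ((complexes_shortExact h P).homology_exact₃ (n + 1) n (by simp))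
  · dsimp only
    rw [ProjectiveResolution.leftDerived_app_eq β P (n + 1)]
    exact Iso.inv_hom_id_assoc _ _
  · exact Iso.inv_hom_id_assoc _ _

lemma exact_leftDerived (h : ExactOnProjectives α β w) (n : ℕ) (X : C) :
    (ShortComplex.mk _ _ (leftDerived_comp_eq_zero w n X)).Exact := by
  let P := projectiveResolution X
  refine ShortComplex.exact_of_iso (ShortComplex.isoMk (P.isoLeftDerivedObj F n).symm
    (P.isoLeftDerivedObj G n).symm (P.isoLeftDerivedObj H n).symm ?_ ?_)
    ((complexes_shortExact h P).homology_exact₂ n)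
  · dsimp only
    rw [ProjectiveResolution.leftDerived_app_eq α P n]
    exact Iso.inv_hom_id_assoc _ _
  · dsimp only
    rw [ProjectiveResolution.leftDerived_app_eq β P n]
    exact Iso.inv_hom_id_assoc _ _

end LeftDerivedConnecting

/-! ### Ext: long exact sequence, multiplication maps, degree zero -/

section ExtSequence

variable {A : Type u} [CommRing A]

/-- The module `Ext^i(X, N)`. -/
abbrev extObj (i : ℕ) (X N : ModuleCat.{u} A) : ModuleCat.{u} A :=
  ((Ext A (ModuleCat.{u} A) i).obj (Opposite.op X)).obj N

/-- `Ext^i(X, N) ⟶ Ext^i(X, N')`. -/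
abbrev extPush (i : ℕ) (X : ModuleCat.{u} A) {N N' : ModuleCat.{u} A} (f : N ⟶ N') :
    extObj i X N ⟶ extObj i X N' :=
  ((Ext A (ModuleCat.{u} A) i).obj (Opposite.op X)).map f

/-- `Ext^i(X', N) ⟶ Ext^i(X, N)`. -/
abbrev extPull (i : ℕ) {X X' : ModuleCat.{u} A} (g : X ⟶ X') (N : ModuleCat.{u} A) :
    extObj i X' N ⟶ extObj i X N :=
  ((Ext A (ModuleCat.{u} A) i).map g.op).app N

/-- `Ext^i(X, S.X₃) ⟶ Ext^{i+1}(X, S.X₁)`. -/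
abbrev extDelta {S : ShortComplex (ModuleCat.{u} A)} (hS : S.ShortExact) (i : ℕ)
    (X : ModuleCat.{u} A) : extObj i X S.X₃ ⟶ extObj (i + 1) X S.X₁ :=
  (extConnecting hS i).app (Opposite.op X)

lemma extPush_eq (i : ℕ) (X : ModuleCat.{u} A) {N N' : ModuleCat.{u} A} (f : N ⟶ N') :
    extPush i X f = ((NatTrans.leftDerived (homIntoMap f) i).app X).unop := rfl

lemma extPull_eq (i : ℕ) {X X' : ModuleCat.{u} A} (g : X ⟶ X') (N : ModuleCat.{u} A) :
    extPull i g N = (((homInto N).leftDerived i).map g).unop := rfl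

variable {S : ShortComplex (ModuleCat.{u} A)} (hS : S.ShortExact)

/-- `homInto` takes values in the opposite category, so `unop` reverses the derived sequence:
exactness to the right of the connecting map there gives exactness at Ext^{i+1}(X, S.X₁) here. -/
lemma ext_exact₁ (i : ℕ) (X : ModuleCat.{u} A) (c : extObj (i + 1) X S.X₁)
    (hc : extPush (i + 1) X S.f c = 0) : ∃ b : extObj i X S.X₃, extDelta hS i X b = c :=
  (ShortComplex.moduleCat_exact_iff _).1
    (LeftDerivedConnecting.exact_connecting_right (homInto_exactOnProjectives hS) i X).unop c hc

lemma ext_exact₂ (hS : S.ShortExact) (i : ℕ) (X : ModuleCat.{u} A) (c : extObj i X S.X₂)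
    (hc : extPush i X S.g c = 0) : ∃ b : extObj i X S.X₁, extPush i X S.f b = c :=
  (ShortComplex.moduleCat_exact_iff _).1
    (LeftDerivedConnecting.exact_leftDerived (homInto_exactOnProjectives hS) i X).unop c hc

lemma ext_exact₃ (i : ℕ) (X : ModuleCat.{u} A) (c : extObj i X S.X₃)
    (hc : extDelta hS i X c = 0) : ∃ b : extObj i X S.X₂, extPush i X S.g b = c :=
  (ShortComplex.moduleCat_exact_iff _).1
    (LeftDerivedConnecting.exact_connecting_left (homInto_exactOnProjectives hS) i X).unop c hc

lemma extPush_extDelta (i : ℕ) (X : ModuleCat.{u} A) (c : extObj i X S.X₃) :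
    extPush (i + 1) X S.f (extDelta hS i X c) = 0 := by
  have h := congrArg Quiver.Hom.unop
    (LeftDerivedConnecting.comp_connecting (homInto_exactOnProjectives hS) i X)
  exact congrArg (fun t => t.hom c) h

lemma extDelta_extPush (i : ℕ) (X : ModuleCat.{u} A) (c : extObj i X S.X₂) :
    extDelta hS i X (extPush i X S.g c) = 0 := by
  have h := congrArg Quiver.Hom.unop
    (LeftDerivedConnecting.connecting_comp (homInto_exactOnProjectives hS) i X)
  exact congrArg (fun t => t.hom c) h

lemma extPull_extDelta (i : ℕ) {X X' : ModuleCat.{u} A} (g : X ⟶ X') (c : extObj i X' S.X₃) :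
    extPull (i + 1) g S.X₁ (extDelta hS i X' c) = extDelta hS i X (extPull i g S.X₃ c) :=
  (congrArg (fun t => t.hom c) ((extConnecting hS i).naturality g.op)).symm

lemma extPull_extPush (i : ℕ) {X X' : ModuleCat.{u} A} (g : X ⟶ X') {N N' : ModuleCat.{u} A}
    (f : N ⟶ N') (c : extObj i X' N) :
    extPull i g N' (extPush i X' f c) = extPush i X f (extPull i g N c) :=
  congrArg (fun t => t.hom c) (((Ext A (ModuleCat.{u} A) i).map g.op).naturality f)

lemma extPull_comp (i : ℕ) {X X' X'' : ModuleCat.{u} A} (g : X ⟶ X') (g' : X' ⟶ X'')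
    (N : ModuleCat.{u} A) (c : extObj i X'' N) :
    extPull i g N (extPull i g' N c) = extPull i (g ≫ g') N c := by
  rw [extPull, extPull, extPull, op_comp, Functor.map_comp]
  rfl

/-- `Ext^{i+1}(X, E) = 0` for `E` injective. -/
lemma extObj_succ_eq_zero_of_injective (i : ℕ) (X E : ModuleCat.{u} A) [Injective E]
    (c : extObj (i + 1) X E) : c = 0 := by
  have : IsZero (extObj (i + 1) X E) := by
    refine IsZero.of_iso ?_ ((projectiveResolution X).isoExt (i + 1) E)
    rw [← HomologicalComplex.exactAt_iff_isZero_homology,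
      HomologicalComplex.exactAt_iff' _ i (i + 1) (i + 1 + 1) (by simp) (by simp),
      ShortComplex.moduleCat_exact_iff]
    intro (x : (projectiveResolution X).complex.X (i + 1) ⟶ E)
      (hx : (projectiveResolution X).complex.d (i + 1 + 1) (i + 1) ≫ x = 0)
    -- By exactness of the resolution, a cocycle factors through the image of the next differential;
    -- injectivity of `E` extends it to degree `i`.
    have hex := (projectiveResolution X).complex_exactAt_succ i
    rw [HomologicalComplex.exactAt_iff' _ (i + 1 + 1) (i + 1) i (by simp) (by simp)] at hex
    exact ⟨hex.descToInjective x hx, hex.comp_descToInjective x hx⟩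
  have hs := ModuleCat.subsingleton_of_isZero this
  exact Subsingleton.elim _ _

/-- Multiplication by `a` on a module, as a morphism. -/
abbrev smulHom (a : A) (N : ModuleCat.{u} A) : N ⟶ N := a • 𝟙 N

/-- Multiplication by `a` on `Ext` may be computed in either variable. -/
lemma extPush_smulHom (i : ℕ) (a : A) (X N : ModuleCat.{u} A) :
    extPush i X (smulHom a N) = extPull i (smulHom a X) N := by
  rw [extPush_eq, extPull_eq]
  congr 1
  let P := projectiveResolution X
  rw [ProjectiveResolution.leftDerived_app_eq _ P,
    -- Multiplication by `a` on `X` lifts to degreewise multiplication on the resolution, and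
    -- precomposing with it agrees with postcomposing by multiplication on `N`.
    Functor.leftDerived_map_eq (homInto N) i (smulHom a X) (P := P) (Q := P)
      { f := fun n => smulHom a (P.complex.X n) } (by
        ext : 1
        simp only [HomologicalComplex.comp_f, ChainComplex.single₀_map_f_zero]
        exact ((Linear.smul_comp _ _ _ a (𝟙 _) (P.π.f 0)).trans
          (congrArg (a • ·) ((Category.id_comp _).trans (Category.comp_id _).symm))).trans
          (Linear.comp_smul _ _ _ (P.π.f 0) a (𝟙 _)).symm)]
  congr 2
  change _ = (HomologicalComplex.homologyFunctor _ _ i).map _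
  congr 1
  ext n
  apply Quiver.Hom.unop_inj
  ext (x : P.complex.X n ⟶ N)
  change x ≫ smulHom a N = smulHom a _ ≫ x
  simp

/-- Naturality in the functor of the comparison L_0 F → F. It makes the identification of Ext^0 with
Hom natural in the second variable. -/
lemma leftDerived_fromLeftDerivedZero {C : Type*} [Category* C] {D : Type*} [Category* D]
    [Abelian C] [HasProjectiveResolutions C] [Abelian D] {F G : C ⥤ D} [F.Additive] [G.Additive]
    (α : F ⟶ G) (X : C) :
    (NatTrans.leftDerived α 0).app X ≫ G.fromLeftDerivedZero.app X =
      F.fromLeftDerivedZero.app X ≫ α.app X := by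
  let P := projectiveResolution X
  have h : HomologicalComplex.opcyclesMap
      ((NatTrans.mapHomologicalComplex α (ComplexShape.down ℕ)).app P.complex) 0 ≫
        P.fromLeftDerivedZero' G = P.fromLeftDerivedZero' F ≫ α.app X := by
    rw [← cancel_epi (HomologicalComplex.pOpcycles _ _)]
    rw [HomologicalComplex.p_opcyclesMap_assoc,
      ProjectiveResolution.pOpcycles_comp_fromLeftDerivedZero'_assoc,
      ProjectiveResolution.pOpcycles_comp_fromLeftDerivedZero']
    exact (α.naturality (P.π.f 0)).symm
  have h' := HomologicalComplex.homologyι_naturality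
      ((NatTrans.mapHomologicalComplex α (ComplexShape.down ℕ)).app P.complex) 0
  rw [P.fromLeftDerivedZero_eq F, P.fromLeftDerivedZero_eq G, P.leftDerived_app_eq α 0]
  simp only [Category.assoc, Iso.inv_hom_id_assoc]
  refine congrArg ((P.isoLeftDerivedObj F 0).hom ≫ ·) ?_
  exact ((reassoc_of% h') (P.fromLeftDerivedZero' G)).trans
    ((congrArg (HomologicalComplex.homologyι _ 0 ≫ ·) h).trans (Category.assoc _ _ _).symm)

instance (N : ModuleCat.{u} A) : PreservesFiniteColimits (homInto N) := by
  have : PreservesLimits ((linearYoneda A (ModuleCat.{u} A)).obj N ⋙ forget (ModuleCat.{u} A)) :=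
    inferInstanceAs (PreservesLimits (yoneda.obj N))
  have : PreservesLimits ((linearYoneda A (ModuleCat.{u} A)).obj N) :=
    preservesLimits_of_reflects_of_preserves _ (forget (ModuleCat.{u} A))
  have := preservesColimits_rightOp ((linearYoneda A (ModuleCat.{u} A)).obj N)
  infer_instance

/-- The class in `Ext^0(X, N)` of a morphism. -/
def homToExt {X N : ModuleCat.{u} A} (φ : X ⟶ N) : extObj 0 X N :=
  ((homInto N).fromLeftDerivedZero.app X).unop φ

/-- `homInto N` preserves finite colimits, so it agrees with its zeroth left derived functor. -/
lemma homToExt_bijective (X N : ModuleCat.{u} A) :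
    Function.Bijective (homToExt : (X ⟶ N) → extObj 0 X N) :=
  ConcreteCategory.bijective_of_isIso ((homInto N).fromLeftDerivedZero.app X).unop

lemma homToExt_zero (X N : ModuleCat.{u} A) : homToExt (0 : X ⟶ N) = 0 :=
  map_zero ((homInto N).fromLeftDerivedZero.app X).unop.hom

lemma extPush_homToExt {X N N' : ModuleCat.{u} A} (f : N ⟶ N') (φ : X ⟶ N) :
    extPush 0 X f (homToExt φ) = homToExt (φ ≫ f) :=
  congrArg (fun t => t.unop.hom φ) (leftDerived_fromLeftDerivedZero (homIntoMap f) X)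

lemma extPull_homToExt {X X' N : ModuleCat.{u} A} (g : X ⟶ X') (φ : X' ⟶ N) :
    extPull 0 g N (homToExt φ) = homToExt (g ≫ φ) :=
  congrArg (fun t => t.unop.hom φ) ((homInto N).fromLeftDerivedZero.naturality g)

end ExtSequence

/-! ### Power torsion modules and injectivity -/

section PowerTorsion

variable {A : Type u} [CommRing A]

/-- Every element of `N` is annihilated by a power of `J`. -/
def IsPowerTorsion (J : Ideal A) (N : Type*) [AddCommGroup N] [Module A N] : Prop :=
  ∀ x : N, ∃ n : ℕ, ∀ a ∈ J ^ n, a • x = 0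

/-- The submodule of elements annihilated by a power of `J`. -/
def powerTorsion (J : Ideal A) (N : Type*) [AddCommGroup N] [Module A N] : Submodule A N where
  carrier := {x | ∃ n : ℕ, ∀ a ∈ J ^ n, a • x = 0}
  zero_mem' := ⟨0, by simp⟩
  add_mem' := by
    rintro x y ⟨m, hm⟩ ⟨n, hn⟩
    refine ⟨max m n, fun a ha => ?_⟩
    rw [smul_add, hm a (Ideal.pow_le_pow_right (le_max_left m n) ha),
      hn a (Ideal.pow_le_pow_right (le_max_right m n) ha), add_zero]
  smul_mem' := by
    rintro c x ⟨n, hn⟩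
    exact ⟨n, fun a ha => by rw [smul_comm, hn a ha, smul_zero]⟩

lemma isPowerTorsion_powerTorsion (J : Ideal A) (N : Type*) [AddCommGroup N] [Module A N] :
    IsPowerTorsion J (powerTorsion J N) := fun x =>
  x.2.imp fun _ hn a ha => Subtype.ext (hn a ha)

lemma IsPowerTorsion.quotient {J : Ideal A} {N : Type*} [AddCommGroup N] [Module A N]
    (h : IsPowerTorsion J N) (P : Submodule A N) : IsPowerTorsion J (N ⧸ P) := by
  intro x
  obtain ⟨x, rfl⟩ := P.mkQ_surjective x
  exact (h x).imp fun _ hn a ha => by rw [← map_smul, hn a ha, map_zero]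

lemma IsPowerTorsion.exists_of_fg {J : Ideal A} {N : Type*} [AddCommGroup N] [Module A N]
    (h : IsPowerTorsion J N) {P : Submodule A N} (hP : P.FG) :
    ∃ n : ℕ, ∀ a ∈ J ^ n, ∀ x ∈ P, a • x = 0 := by
  induction P, hP using Submodule.fg_induction with
  | singleton x =>
    obtain ⟨n, hn⟩ := h x
    refine ⟨n, fun a ha y hy => ?_⟩
    obtain ⟨c, rfl⟩ := Submodule.mem_span_singleton.1 hy
    rw [smul_comm, hn a ha, smul_zero]
  | sup P Q _ _ hP hQ =>
    obtain ⟨m, hm⟩ := hP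
    obtain ⟨n, hn⟩ := hQ
    refine ⟨max m n, fun a ha z hz => ?_⟩
    obtain ⟨x, hx, y, hy, rfl⟩ := Submodule.mem_sup.1 hz
    rw [smul_add, hm a (Ideal.pow_le_pow_right (le_max_left m n) ha) x hx,
      hn a (Ideal.pow_le_pow_right (le_max_right m n) ha) y hy, add_zero]

/-- Over a Noetherian ring, the power torsion of an injective module is injective. -/
lemma injective_powerTorsion [IsNoetherianRing A] (J : Ideal A) (E : Type u) [AddCommGroup E]
    [Module A E] [hE : Module.Injective A E] : Module.Injective A (powerTorsion J E) := by
  apply Module.Baer.injective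
  intro 𝔞 g
  obtain ⟨s, hs⟩ := (isPowerTorsion_powerTorsion J E).exists_of_fg
    (P := LinearMap.range g) (Module.Finite.iff_fg.1 inferInstance)
  -- Artin–Rees: J^{k+s} ∩ 𝔞 = J^s (J^k ∩ 𝔞), and `g` kills this because J^s annihilates its
  -- finitely generated image.
  obtain ⟨k, hk⟩ := Ideal.exists_pow_inf_eq_pow_smul J (M := A) 𝔞
  set n := k + s
  have hn : ∀ x : 𝔞, (x : A) ∈ J ^ n → g x = 0 := by
    have key : J ^ n ⊓ 𝔞 ≤ (LinearMap.ker g).map 𝔞.subtype := by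
      have h1 := hk n (Nat.le_add_right k s)
      rw [show n - k = s by omega, smul_eq_mul, Ideal.mul_top] at h1
      rw [h1, Submodule.smul_le]
      intro r hr x hx
      refine ⟨r • ⟨x, hx.2⟩, ?_, rfl⟩
      change g (r • _) = 0
      rw [map_smul]
      exact hs r hr _ ⟨_, rfl⟩
    intro x hx
    obtain ⟨y, hy, hyx⟩ := key ⟨hx, x.2⟩
    rw [← Subtype.ext hyx]
    exact hy
  -- Now `g` factors through 𝔞/(𝔞 ∩ J^n) ⊆ A/J^n. An extension to A/J^n with values in `E` has image
  -- killed by J^n, so it lands in the torsion.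
  let i := Submodule.mapQ (Submodule.comap 𝔞.subtype (J ^ n)) (J ^ n) 𝔞.subtype le_rfl
  have hi : Function.Injective i := by
    rw [← LinearMap.ker_eq_bot, LinearMap.ker_eq_bot']
    intro x hx
    obtain ⟨x, rfl⟩ := Submodule.mkQ_surjective _ x
    exact (Submodule.Quotient.mk_eq_zero _).2 ((Submodule.Quotient.mk_eq_zero (J ^ n)).1 hx)
  let gq := Submodule.liftQ (Submodule.comap 𝔞.subtype (J ^ n)) ((powerTorsion J E).subtype ∘ₗ g)
    (fun x hx => by
      change ((g x : powerTorsion J E) : E) = 0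
      rw [hn x hx]; rfl)
  obtain ⟨h, hh⟩ := hE.out i hi gq
  refine ⟨LinearMap.codRestrict (powerTorsion J E) (h ∘ₗ (J ^ n).mkQ) fun a => ⟨n, fun b hb => ?_⟩,
    fun x hx => Subtype.ext (hh (Submodule.Quotient.mk ⟨x, hx⟩))⟩
  rw [← map_smul]
  exact (congrArg h ((Submodule.Quotient.mk_eq_zero (J ^ n)).2
    (Ideal.mul_mem_right a _ hb))).trans (map_zero h)

end PowerTorsion

/-! ### Vanishing of local cohomology, tested on Ext classes -/

section LocalCohomology

open localCohomology

variable {A : Type u} [CommRing A]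

/-- The module `A/J^t`. -/
abbrev quotPow (J : Ideal A) (t : ℕ) : ModuleCat.{u} A :=
  (ringModIdeals (idealPowersDiagram J)).obj (Opposite.op t)

/-- The projection `A/J^s ⟶ A/J^t` for `t ≤ s`. -/
abbrev quotPowMap (J : Ideal A) {t s : ℕ} (h : t ≤ s) : quotPow J s ⟶ quotPow J t :=
  (ringModIdeals (idealPowersDiagram J)).map (homOfLE h).op

lemma quotPowMap_comp (J : Ideal A) {t s r : ℕ} (h : t ≤ s) (h' : s ≤ r) :
    quotPowMap J h' ≫ quotPowMap J h = quotPowMap J (h.trans h') := by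
  rw [quotPowMap, quotPowMap, quotPowMap, ← Functor.map_comp]
  rfl

variable {J : Ideal A} {N : ModuleCat.{u} A}

/-- The class `c ∈ Ext^i(A/J^t, N)` vanishes in the direct limit. -/
def EventuallyZero {i t : ℕ} (c : extObj i (quotPow J t) N) : Prop :=
  ∃ (s : ℕ) (h : t ≤ s), extPull i (quotPowMap J h) N c = 0

lemma EventuallyZero.of_extPull {i t s : ℕ} {h : t ≤ s} {c : extObj i (quotPow J t) N}
    (hc : EventuallyZero (extPull i (quotPowMap J h) N c)) : EventuallyZero c := by
  obtain ⟨r, h', hr⟩ := hc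
  exact ⟨r, h.trans h', by rw [← quotPowMap_comp J h h', ← extPull_comp, hr]⟩

lemma EventuallyZero.push {i t : ℕ} {c : extObj i (quotPow J t) N} (hc : EventuallyZero c)
    {N' : ModuleCat.{u} A} (f : N ⟶ N') : EventuallyZero (extPush i _ f c) := by
  obtain ⟨s, h, hs⟩ := hc
  exact ⟨s, h, by rw [extPull_extPush, hs, map_zero]⟩

lemma EventuallyZero.delta {S : ShortComplex (ModuleCat.{u} A)} {hS : S.ShortExact} {i t : ℕ}
    {c : extObj i (quotPow J t) S.X₃} (hc : EventuallyZero c) :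
    EventuallyZero (extDelta hS i _ c) := by
  obtain ⟨s, h, hs⟩ := hc
  exact ⟨s, h, by rw [extPull_extDelta, hs, map_zero]⟩

lemma eventuallyZero_zero {i t : ℕ} : EventuallyZero (0 : extObj i (quotPow J t) N) :=
  ⟨t, le_rfl, map_zero _⟩

variable (J N) in
/-- The vanishing of `H^i_J(N)`. -/
def LocalCohomologyVanishes (i : ℕ) : Prop :=
  ∀ (t : ℕ) (c : extObj i (quotPow J t) N), EventuallyZero c

/-- Once the image of the class vanishes at a stage `s`, exactness of Ext at that stage lifts the
restricted class to the neighbouring term, where the lift dies further on. The next two lemmas use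
the same argument at the other two places of the long exact sequence. -/
lemma eventuallyZero_of_push_f {S : ShortComplex (ModuleCat.{u} A)} (hS : S.ShortExact) {i t : ℕ}
    (h₃ : LocalCohomologyVanishes J S.X₃ i) (c : extObj (i + 1) (quotPow J t) S.X₁)
    (hc : EventuallyZero (extPush (i + 1) _ S.f c)) : EventuallyZero c := by
  obtain ⟨s, h, hs⟩ := hc
  rw [extPull_extPush] at hs
  obtain ⟨b, hb⟩ := ext_exact₁ hS i _ _ hs
  exact .of_extPull (hb ▸ (h₃ s b).delta)

lemma eventuallyZero_of_push_g {S : ShortComplex (ModuleCat.{u} A)} (hS : S.ShortExact) {i t : ℕ}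
    (h₁ : LocalCohomologyVanishes J S.X₁ i) (c : extObj i (quotPow J t) S.X₂)
    (hc : EventuallyZero (extPush i _ S.g c)) : EventuallyZero c := by
  obtain ⟨s, h, hs⟩ := hc
  rw [extPull_extPush] at hs
  obtain ⟨b, hb⟩ := ext_exact₂ hS i _ _ hs
  exact .of_extPull (hb ▸ (h₁ s b).push _)

lemma eventuallyZero_of_delta {S : ShortComplex (ModuleCat.{u} A)} (hS : S.ShortExact) {i t : ℕ}
    (h₂ : LocalCohomologyVanishes J S.X₂ i) (c : extObj i (quotPow J t) S.X₃)
    (hc : EventuallyZero (extDelta hS i _ c)) : EventuallyZero c := by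
  obtain ⟨s, h, hs⟩ := hc
  rw [extPull_extDelta] at hs
  obtain ⟨b, hb⟩ := ext_exact₃ hS i _ _ hs
  exact .of_extPull (hb ▸ (h₂ s b).push _)

lemma LocalCohomologyVanishes.middle {S : ShortComplex (ModuleCat.{u} A)} (hS : S.ShortExact)
    {i : ℕ} (h₁ : LocalCohomologyVanishes J S.X₁ i) (h₃ : LocalCohomologyVanishes J S.X₃ i) :
    LocalCohomologyVanishes J S.X₂ i := fun t c =>
  eventuallyZero_of_push_g hS h₁ c (h₃ t _)

/-- Links multiplication by `n` in `A` to the ℤ-module structure, over which the associated primes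
are taken. -/
lemma extPull_smulHom_natCast (i n : ℕ) (X N : ModuleCat.{u} A) (c : extObj i X N) :
    extPull i (smulHom (n : A) X) N c = (n : ℤ) • c := by
  let P := projectiveResolution X
  have h : ((homInto N).leftDerived i).map (smulHom (n : A) X) = n • 𝟙 _ := by
    rw [Functor.leftDerived_map_eq (homInto N) i (smulHom (n : A) X) (P := P) (Q := P)
      (n • 𝟙 P.complex) (by
        rw [Preadditive.nsmul_comp, Category.id_comp, smulHom, Nat.cast_smul_eq_nsmul,
          Functor.map_nsmul, Preadditive.comp_nsmul, CategoryTheory.Functor.map_id, Category.comp_id])]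
    rw [Functor.map_nsmul, CategoryTheory.Functor.map_id, Preadditive.nsmul_comp, Preadditive.comp_nsmul]
    congr 1
    erw [Category.id_comp]
    exact Iso.hom_inv_id _
  rw [extPull_eq, h, natCast_zsmul]
  have h2 : (n • 𝟙 (((homInto N).leftDerived i).obj X)).unop = n • 𝟙 (extObj i X N) := by
    exact map_nsmul (unopHom _ _) n _
  rw [h2]
  exact congrArg (fun f => f c) (ModuleCat.hom_nsmul n (𝟙 (extObj i X N)))

lemma extPull_zero (i : ℕ) (X X' N : ModuleCat.{u} A) (c : extObj i X' N) :
    extPull i (0 : X ⟶ X') N c = 0 := by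
  have h : (0 : X ⟶ X') = smulHom ((0 : ℕ) : A) X ≫ 0 := by simp
  rw [h, ← extPull_comp, extPull_smulHom_natCast]
  simp

lemma extPush_smulHom_pow_of_mem {y : A} (hy : y ∈ J) (i t : ℕ) (c : extObj i (quotPow J t) N) :
    extPush i _ (smulHom (y ^ t) N) c = 0 := by
  have h : smulHom (y ^ t) (quotPow J t) = 0 := by
    ext x
    obtain ⟨x, rfl⟩ := Submodule.mkQ_surjective _ x
    exact (Submodule.Quotient.mk_eq_zero (J ^ t)).2
      (Ideal.mul_mem_right x _ (Ideal.pow_mem_pow hy t))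
  rw [extPush_smulHom, h, extPull_zero]

lemma extPush_comp (i : ℕ) (X : ModuleCat.{u} A) {N N' N'' : ModuleCat.{u} A} (f : N ⟶ N')
    (g : N' ⟶ N'') (c : extObj i X N) :
    extPush i X (f ≫ g) c = extPush i X g (extPush i X f c) := by
  rw [extPush, Functor.map_comp]
  rfl

/-- If multiplication by some `y ∈ J` is injective on `H^i_J(N)`, then `H^i_J(N) = 0`. -/
lemma LocalCohomologyVanishes.of_smul {y : A} (hy : y ∈ J) {i : ℕ}
    (H : ∀ (t : ℕ) (c : extObj i (quotPow J t) N), extPush i _ (smulHom y N) c = 0 →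
      EventuallyZero c) : LocalCohomologyVanishes J N i := by
  have key : ∀ (k t : ℕ) (c : extObj i (quotPow J t) N),
      extPush i _ (smulHom (y ^ k) N) c = 0 → EventuallyZero c := by
    intro k
    induction k with
    | zero =>
      intro t c hc
      rw [pow_zero, smulHom, one_smul, extPush, CategoryTheory.Functor.map_id] at hc
      have : c = 0 := hc
      exact this ▸ eventuallyZero_zero
    | succ k ih =>
      intro t c hc
      have h1 : smulHom (y ^ (k + 1)) N = smulHom (y ^ k) N ≫ smulHom y N := by
        rw [smulHom, smulHom, smulHom, Linear.smul_comp, Category.id_comp, smul_smul, pow_succ]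
      rw [h1, extPush_comp] at hc
      obtain ⟨s, h, hs⟩ := H t _ hc
      rw [extPull_extPush] at hs
      exact .of_extPull (ih s _ hs)
  -- A class over A/J^t is killed by y^t, since y^t acts as zero on A/J^t.
  exact fun t c => key t t c (extPush_smulHom_pow_of_mem hy i t c)

lemma LocalCohomologyVanishes.zero_of_smul_injective {y : A} (hy : y ∈ J)
    (hN : ∀ x : N, y • x = 0 → x = 0) : LocalCohomologyVanishes J N 0 := by
  refine .of_smul hy fun t c hc => ?_
  obtain ⟨φ, rfl⟩ := (homToExt_bijective _ _).2 c
  rw [extPush_homToExt, ← homToExt_zero] at hc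
  have h0 := (homToExt_bijective _ _).1 hc
  have : φ = 0 := by
    ext x
    exact hN _ (congrArg (fun t => t.hom x) h0)
  rw [this, homToExt_zero]
  exact eventuallyZero_zero

/-- The sequence `N → N → N/yN`. -/
def smulSequence (y : A) (N : ModuleCat.{u} A) : ShortComplex (ModuleCat.{u} A) where
  X₁ := N
  X₂ := N
  X₃ := ModuleCat.of A (N ⧸ LinearMap.range (smulHom y N).hom)
  f := smulHom y N
  g := ModuleCat.ofHom (Submodule.mkQ _)
  zero := by
    ext x
    exact (Submodule.Quotient.mk_eq_zero _).2 ⟨x, rfl⟩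

lemma smulSequence_shortExact {y : A} (hN : ∀ x : N, y • x = 0 → x = 0) :
    (smulSequence y N).ShortExact := by
  refine ShortComplex.ShortExact.mk' ?_ ?_ ?_
  · rw [ShortComplex.moduleCat_exact_iff]
    intro x hx
    exact (Submodule.Quotient.mk_eq_zero _).1 hx
  · rw [ModuleCat.mono_iff_injective]
    exact (injective_iff_map_eq_zero (smulHom y N).hom).2 hN
  · rw [ModuleCat.epi_iff_surjective]
    exact Submodule.mkQ_surjective _

/-- The kernel of `y` on H^{i+1}(N) comes from H^i(N/yN) = 0, so `y` acts injectively, while every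
class is killed by a power of `y`. -/
lemma LocalCohomologyVanishes.succ_of_smul {y : A} (hy : y ∈ J)
    (hN : ∀ x : N, y • x = 0 → x = 0) {i : ℕ}
    (h : LocalCohomologyVanishes J (smulSequence y N).X₃ i) :
    LocalCohomologyVanishes J N (i + 1) := by
  refine .of_smul hy fun t c hc => ?_
  refine eventuallyZero_of_push_f (smulSequence_shortExact hN) h c ?_
  have : extPush (i + 1) _ (smulSequence y N).f c = 0 := hc
  rw [this]
  exact eventuallyZero_zero

/-- The sequence `N → N' → N'/N` of an injective linear map. -/
def cokernelSequence {N N' : Type u} [AddCommGroup N] [Module A N] [AddCommGroup N'] [Module A N']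
    (f : N →ₗ[A] N') : ShortComplex (ModuleCat.{u} A) where
  X₁ := ModuleCat.of A N
  X₂ := ModuleCat.of A N'
  X₃ := ModuleCat.of A (N' ⧸ LinearMap.range f)
  f := ModuleCat.ofHom f
  g := ModuleCat.ofHom (Submodule.mkQ _)
  zero := by
    ext x
    exact (Submodule.Quotient.mk_eq_zero _).2 ⟨x, rfl⟩

lemma cokernelSequence_shortExact {N N' : Type u} [AddCommGroup N] [Module A N] [AddCommGroup N']
    [Module A N'] {f : N →ₗ[A] N'} (hf : Function.Injective f) :
    (cokernelSequence f).ShortExact := by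
  refine ShortComplex.ShortExact.mk' ?_ ?_ ?_
  · rw [ShortComplex.moduleCat_exact_iff]
    intro x hx
    exact (Submodule.Quotient.mk_eq_zero _).1 hx
  · rw [ModuleCat.mono_iff_injective]
    exact hf
  · rw [ModuleCat.epi_iff_surjective]
    exact Submodule.mkQ_surjective _

/-- A morphism `A/J^t ⟶ N'` lifts, after restriction to some `A/J^s`, along a surjection onto `N'`
from a power torsion module. -/
lemma exists_lift_of_isPowerTorsion {N N' : ModuleCat.{u} A} (hN : IsPowerTorsion J N) (g : N ⟶ N')
    [Epi g] {t : ℕ} (φ : quotPow J t ⟶ N') :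
    ∃ (s : ℕ) (h : t ≤ s) (ψ : quotPow J s ⟶ N), ψ ≫ g = quotPowMap J h ≫ φ := by
  obtain ⟨e, he⟩ := (ModuleCat.epi_iff_surjective g).1 inferInstance
    (φ.hom (Submodule.mkQ (J ^ t) (1 : A)))
  obtain ⟨m, hm⟩ := hN e
  have hle : J ^ max t m ≤ LinearMap.ker (LinearMap.toSpanSingleton A N e) := fun a ha =>
    hm a (Ideal.pow_le_pow_right (le_max_right t m) ha)
  refine ⟨max t m, le_max_left t m, ModuleCat.ofHom (Submodule.liftQ (J ^ max t m) _ hle), ?_⟩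
  apply ModuleCat.hom_ext
  refine Submodule.linearMap_qext (J ^ max t m) (LinearMap.ext_ring ?_)
  change g.hom ((1 : A) • e) = φ.hom (Submodule.mkQ (J ^ t) (1 : A))
  rw [one_smul]
  exact he

/-- Over a Noetherian ring, a power torsion module embeds in a power torsion injective module. -/
lemma exists_shortExact_of_isPowerTorsion [IsNoetherianRing A] (hN : IsPowerTorsion J N) :
    ∃ (E N' : ModuleCat.{u} A) (f : N ⟶ E) (g : E ⟶ N') (w : f ≫ g = 0),
      (ShortComplex.mk f g w).ShortExact ∧ Injective E ∧ IsPowerTorsion J E ∧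
        IsPowerTorsion J N' := by
  have : Module.Injective A (Injective.under N : ModuleCat.{u} A) :=
    Module.injective_module_of_injective_object A _
      (inj := inferInstanceAs (Injective (Injective.under N)))
  have hi : Function.Injective (Injective.ι N).hom :=
    (ModuleCat.mono_iff_injective (Injective.ι N)).1 inferInstance
  let f : N →ₗ[A] powerTorsion J (Injective.under N : ModuleCat.{u} A) :=
    LinearMap.codRestrict _ (Injective.ι N).hom fun x =>
      (hN x).imp fun _ hn a ha => by rw [← map_smul, hn a ha, map_zero]
  have hf : Function.Injective f := fun x y hxy => hi (congrArg Subtype.val hxy)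
  have hT := isPowerTorsion_powerTorsion J (Injective.under N : ModuleCat.{u} A)
  have := injective_powerTorsion J (Injective.under N : ModuleCat.{u} A)
  exact ⟨_, _, _, _, _, cokernelSequence_shortExact hf,
    Module.injective_object_of_injective_module A _, hT, hT.quotient _⟩

/-- Over a Noetherian ring, power torsion modules have no local cohomology in positive degrees. -/
lemma LocalCohomologyVanishes.of_isPowerTorsion [IsNoetherianRing A] (hN : IsPowerTorsion J N)
    (i : ℕ) : LocalCohomologyVanishes J N (i + 1) := by
  induction i generalizing N with
  | zero =>
    intro t c
    obtain ⟨E, N', f, g, w, hS, hE, hTE, -⟩ := exists_shortExact_of_isPowerTorsion hN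
    obtain ⟨b, rfl⟩ := ext_exact₁ hS 0 _ c (extObj_succ_eq_zero_of_injective _ _ E _)
    obtain ⟨φ, rfl⟩ := (homToExt_bijective _ _).2 b
    have : Epi g := hS.epi_g
    -- After restriction, `φ` lifts to `E`, so its image under the connecting map vanishes.
    obtain ⟨s, h, ψ, hψ⟩ := exists_lift_of_isPowerTorsion hTE g φ
    refine ⟨s, h, (extPull_extDelta hS 0 _ _).trans ?_⟩
    rw [extPull_homToExt, ← hψ, ← extPush_homToExt]
    exact extDelta_extPush hS 0 _ _
  | succ i ih =>
    intro t c
    obtain ⟨E, N', f, g, w, hS, hE, -, hN'⟩ := exists_shortExact_of_isPowerTorsion hN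
    obtain ⟨b, rfl⟩ := ext_exact₁ hS (i + 1) _ c (extObj_succ_eq_zero_of_injective _ _ E _)
    -- Dimension shift: the cokernel is again power torsion.
    exact (ih hN' t b).delta

/-- If `y ∈ J` is regular on `N` and `N/yN` is power torsion, then `H^i_J(N) = 0` for `i ≥ 2`. -/
lemma LocalCohomologyVanishes.of_isPowerTorsion_quotient [IsNoetherianRing A] {y : A} (hy : y ∈ J)
    (hN : ∀ x : N, y • x = 0 → x = 0)
    (h : IsPowerTorsion J (N ⧸ LinearMap.range (smulHom y N).hom)) (i : ℕ) :
    LocalCohomologyVanishes J N (i + 2) :=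
  .succ_of_smul hy hN (.of_isPowerTorsion (N := (smulSequence y N).X₃) h i)

end LocalCohomology

/-! ### Passage to the colimit: associated primes and the Bockstein map -/

section DirectLimit

variable {A : Type} [CommRing A] {J : Ideal A} {N : ModuleCat.{0} A}

lemma LocalCohomologyVanishes.subsingleton {i : ℕ} (h : LocalCohomologyVanishes J N i) :
    Subsingleton ((localCohomology J i).obj N) := by
  have h0 : ∀ x : (localCohomology J i).obj N, x = 0 := by
    intro x
    let e := colimitObjIsoColimitCompEvaluation
      (localCohomology.diagram (localCohomology.idealPowersDiagram J) i) N
    obtain ⟨⟨⟨t⟩⟩, c, hc⟩ := Concrete.colimit_exists_rep _ (e.hom x)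
    obtain ⟨s, hts, hs⟩ := h t c
    have h1 := ConcreteCategory.congr_hom (colimit.w
      (localCohomology.diagram (localCohomology.idealPowersDiagram J) i ⋙
        (evaluation _ _).obj N) (homOfLE hts).op.op) c
    have h2 : e.hom x = 0 := by
      rw [← hc, ← h1]
      exact (congrArg _ hs).trans (map_zero (colimit.ι
        (localCohomology.diagram (localCohomology.idealPowersDiagram J) i ⋙
          (evaluation _ _).obj N) (Opposite.op (Opposite.op s))).hom)
    exact (ModuleCat.mono_iff_injective e.hom).1 inferInstance (h2.trans (map_zero _).symm)
  exact ⟨fun x y => (h0 x).trans (h0 y).symm⟩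

/-- If the prime `p` is not associated to `H^i_J(N)`, classes annihilated by `p` vanish. -/
lemma eventuallyZero_of_smul_prime {p : ℕ} (hp : p.Prime) {i t : ℕ}
    (hass : Ideal.span {(p : ℤ)} ∉ associatedPrimes ℤ ((localCohomology J i).obj N))
    (c : extObj i (quotPow J t) N) (hc : extPush i _ (smulHom (p : A) N) c = 0) :
    EventuallyZero c := by
  let e := colimitObjIsoColimitCompEvaluation
    (localCohomology.diagram (localCohomology.idealPowersDiagram J) i) N
  let F := localCohomology.diagram (localCohomology.idealPowersDiagram J) i ⋙ (evaluation _ _).obj N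
  let z : (colimit F : ModuleCat.{0} A) := colimit.ι F (Opposite.op (Opposite.op t)) c
  rw [extPush_smulHom, extPull_smulHom_natCast] at hc
  have hz : (p : ℤ) • e.inv z = 0 := by
    have : (p : ℤ) • z = 0 := by
      exact (map_zsmul (colimit.ι F (Opposite.op (Opposite.op t))).hom (p : ℤ) c).symm.trans
        ((congrArg _ hc).trans (map_zero _))
    change (p : ℤ) • e.inv.hom z = 0
    rw [← map_zsmul, this, map_zero]
  have hprime : (Ideal.span {(p : ℤ)}).IsPrime :=
    (Ideal.span_singleton_prime (by exact_mod_cast hp.ne_zero)).2 (Nat.prime_iff_prime_int.1 hp)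
  have hmax : (Ideal.span {(p : ℤ)}).IsMaximal :=
    hprime.isMaximal (by simpa using hp.ne_zero)
  have hx : e.inv z = 0 := by
    by_contra hne
    refine hass ⟨hprime, e.inv z, ?_⟩
    -- The annihilator of a nonzero element killed by `p` is proper and contains the maximal ideal
    -- (p). Membership in `associatedPrimes` asks for the radical of this annihilator, hence the
    -- final passage to radicals.
    have hcol : Ideal.span {(p : ℤ)} = (⊥ : Submodule ℤ _).colon {e.inv z} := by
      refine hmax.eq_of_le ?_ ?_
      · rw [Ideal.ne_top_iff_one, Submodule.mem_colon_singleton]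
        simpa using hne
      · rw [Ideal.span_singleton_le_iff_mem, Submodule.mem_colon_singleton, hz]
        exact Submodule.zero_mem _
    exact hprime.radical.symm.trans (congrArg Ideal.radical hcol)
  have hz0 : z = 0 :=
    (ModuleCat.mono_iff_injective e.inv).1 inferInstance (hx.trans (map_zero _).symm)
  obtain ⟨⟨⟨s⟩⟩, g, hg⟩ := Concrete.colimit_rep_eq_zero A F _ c hz0
  exact ⟨s, leOfHom g.unop.unop, hg⟩

/-- The Bockstein homomorphism `H^i_J(A/u) ⟶ H^{i+1}_J(A/u)` vanishes if its source does. -/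
lemma bockstein_succ_eq_zero_of_source {u : A} (hu : u ∈ nonZeroDivisors A) {i : ℕ}
    (h : LocalCohomologyVanishes J (ModuleCat.of A (A ⧸ Ideal.span {u})) i) :
    bockstein J hu (i + 1) = 0 := by
  have := h.subsingleton
  ext x
  have hx : x = 0 := Subsingleton.elim (α := (localCohomology J i).obj _) _ _
  rw [hx]
  exact (map_zero _).trans (map_zero _).symm

/-- The Bockstein homomorphism `H^i_J(A/u) ⟶ H^{i+1}_J(A/u)` vanishes if its target does. -/
lemma bockstein_succ_eq_zero_of_target {u : A} (hu : u ∈ nonZeroDivisors A) {i : ℕ}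
    (h : LocalCohomologyVanishes J (ModuleCat.of A (A ⧸ Ideal.span {u})) (i + 1)) :
    bockstein J hu (i + 1) = 0 := by
  have := h.subsingleton
  ext x
  exact Subsingleton.elim (α := (localCohomology J (i + 1)).obj _) _ _

end DirectLimit

/-! ### One-dimensional quotients and the sequence for a product -/

section TwoDimensional

variable {A : Type u} [CommRing A] {J : Ideal A}

lemma LocalCohomologyVanishes.quotient_of_le [IsNoetherianRing A] {I : Ideal A} (h : J ≤ I)
    (i : ℕ) : LocalCohomologyVanishes J (ModuleCat.of A (A ⧸ I)) (i + 1) := by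
  refine .of_isPowerTorsion (fun m => ⟨1, fun a ha => ?_⟩) i
  obtain ⟨m, rfl⟩ := I.mkQ_surjective m
  rw [pow_one] at ha
  exact (Submodule.Quotient.mk_eq_zero I).2 (Ideal.mul_mem_right m _ (h ha))

lemma smul_quotient_eq_zero {I : Ideal A} [hI : I.IsPrime] {y : A} (hy : y ∉ I) (m : A ⧸ I)
    (hm : y • m = 0) : m = 0 := by
  obtain ⟨m, rfl⟩ := I.mkQ_surjective m
  exact (Submodule.Quotient.mk_eq_zero I).2
    ((hI.mem_or_mem ((Submodule.Quotient.mk_eq_zero I).1 hm)).resolve_left hy)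

lemma LocalCohomologyVanishes.quotient_of_not_le {I : Ideal A} [I.IsPrime] (h : ¬ J ≤ I) :
    LocalCohomologyVanishes J (ModuleCat.of A (A ⧸ I)) 0 := by
  obtain ⟨y, hy, hyI⟩ := Set.not_subset.1 h
  exact .zero_of_smul_injective hy (smul_quotient_eq_zero hyI)

/-- If the maximal ideal is generated by `z` modulo the ideal `I`, then every element outside `I`
divides a power of `z` modulo `I`. -/
lemma exists_pow_mem_span_of_notMem [IsNoetherianRing A] [IsLocalRing A] {I : Ideal A} {z y : A}
    (hm : IsLocalRing.maximalIdeal A ≤ I ⊔ Ideal.span {z}) (hz : z ∈ IsLocalRing.maximalIdeal A)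
    (hI : I ≠ ⊤) (hy : y ∉ I) : ∃ n : ℕ, ∃ c, z ^ n - c * y ∈ I := by
  have hy0 : Ideal.Quotient.mk I y ≠ 0 := fun h => hy (Ideal.Quotient.eq_zero_iff_mem.1 h)
  have : Nontrivial (A ⧸ I) := Ideal.Quotient.nontrivial_iff.2 hI
  have hloc : IsLocalRing (A ⧸ I) :=
    .of_surjective' (Ideal.Quotient.mk I) Ideal.Quotient.mk_surjective
  set w := Ideal.Quotient.mk I z
  have hw : Ideal.span {w} ≠ ⊤ := by
    intro htop
    have h1 : I ⊔ Ideal.span {z} = ⊤ := by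
      have : (Ideal.span {w}).comap (Ideal.Quotient.mk I) = ⊤ := by rw [htop, Ideal.comap_top]
      rw [← Set.image_singleton, ← Ideal.map_span,
        Ideal.comap_map_of_surjective _ Ideal.Quotient.mk_surjective, ← RingHom.ker_eq_comap_bot,
        Ideal.mk_ker, sup_comm] at this
      exact this
    have h2 : I ⊔ Ideal.span {z} ≤ IsLocalRing.maximalIdeal A :=
      sup_le (IsLocalRing.le_maximalIdeal hI) ((Ideal.span_singleton_le_iff_mem _).2 hz)
    rw [h1] at h2
    exact (IsLocalRing.maximalIdeal.isMaximal A).ne_top (top_le_iff.1 h2)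
  -- Krull's intersection theorem: a nonzero element is not divisible by every power of `w`.
  have hex : ∃ n, ¬ w ^ n ∣ Ideal.Quotient.mk I y := by
    by_contra! hall
    refine hy0 ?_
    rw [← Ideal.mem_bot, ← Ideal.iInf_pow_eq_bot_of_isLocalRing _ hw, Ideal.mem_iInf]
    intro n
    rw [Ideal.span_singleton_pow, Ideal.mem_span_singleton]
    exact hall n
  classical
  obtain ⟨n, hn⟩ : ∃ n, Nat.find hex = n + 1 :=
    Nat.exists_eq_succ_of_ne_zero fun h => by simpa [h] using Nat.find_spec hex
  have hnot := Nat.find_spec hex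
  rw [hn] at hnot
  obtain ⟨v, hv⟩ := not_not.1 (Nat.find_min hex (m := n) (by omega))
  obtain ⟨v, rfl⟩ := Ideal.Quotient.mk_surjective v
  -- A nonunit cofactor would lie in I + (z) and contribute one more factor `w`, against the choice
  -- of `n`.
  have hunit : IsUnit v := by
    by_contra hnu
    obtain ⟨a, ha, b, hb, rfl⟩ := Submodule.mem_sup.1
      (hm ((IsLocalRing.mem_maximalIdeal v).2 hnu))
    obtain ⟨b, rfl⟩ := Ideal.mem_span_singleton.1 hb
    refine hnot ⟨Ideal.Quotient.mk I b, ?_⟩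
    rw [hv, map_add, Ideal.Quotient.eq_zero_iff_mem.2 ha, map_mul]
    ring
  obtain ⟨v, rfl⟩ := hunit
  refine ⟨n, ↑v⁻¹, Ideal.Quotient.eq.1 ?_⟩
  rw [map_mul, hv, map_pow, mul_left_comm, ← map_mul, Units.inv_mul, map_one, mul_one]

/-- Local cohomology of a one-dimensional quotient vanishes in degrees at least two. -/
lemma LocalCohomologyVanishes.quotient_add_two [IsNoetherianRing A] [IsLocalRing A] {I : Ideal A}
    [hI : I.IsPrime] {z : A} (hm : IsLocalRing.maximalIdeal A ≤ I ⊔ Ideal.span {z})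
    (hz : z ∈ IsLocalRing.maximalIdeal A) (i : ℕ) :
    LocalCohomologyVanishes J (ModuleCat.of A (A ⧸ I)) (i + 2) := by
  by_cases hJI : J ≤ I
  · exact .quotient_of_le hJI (i + 1)
  -- The unit ideal is not contained in the maximal ideal and is treated apart; with y = 1 the
  -- quotient is zero.
  rcases eq_or_ne J ⊤ with rfl | hJ
  · refine .of_isPowerTorsion_quotient (y := 1) Submodule.mem_top
      (fun x hx => by simpa using hx) (fun m => ⟨0, fun a _ => ?_⟩) i
    obtain ⟨m, rfl⟩ := Submodule.mkQ_surjective _ m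
    exact (Submodule.Quotient.mk_eq_zero _).2 ⟨a • m, one_smul A _⟩
  obtain ⟨y, hy, hyI⟩ := Set.not_subset.1 hJI
  refine .of_isPowerTorsion_quotient hy (smul_quotient_eq_zero hyI) (fun m => ?_) i
  -- Modulo `I`, `y` divides z^n, so z^n kills (A/I)/y; and J^n ⊆ I + (z^n) because J ⊆ I + (z).
  obtain ⟨n, c, hc⟩ := exists_pow_mem_span_of_notMem hm hz hI.ne_top hyI
  refine ⟨n, fun a ha => ?_⟩
  obtain ⟨m, rfl⟩ := Submodule.mkQ_surjective _ m
  obtain ⟨m, rfl⟩ := Submodule.mkQ_surjective _ m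
  have ha' : a ∈ I ⊔ Ideal.span {z ^ n} := by
    have h1 : J ≤ I ⊔ Ideal.span {z} := (IsLocalRing.le_maximalIdeal hJ).trans hm
    have h2 := Ideal.pow_right_mono h1 n ha
    have h3 := Ideal.mem_map_of_mem (Ideal.Quotient.mk I) h2
    rw [Ideal.map_pow, Ideal.map_sup, Ideal.map_quotient_self, bot_sup_eq, ← Ideal.map_pow,
      Ideal.span_singleton_pow] at h3
    have h4 : a ∈ ((Ideal.span {z ^ n}).map (Ideal.Quotient.mk I)).comap (Ideal.Quotient.mk I) := h3
    rwa [Ideal.comap_map_of_surjective _ Ideal.Quotient.mk_surjective, ← RingHom.ker_eq_comap_bot,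
        Ideal.mk_ker, sup_comm] at h4
  obtain ⟨b, hb, d, hd, rfl⟩ := Submodule.mem_sup.1 ha'
  obtain ⟨d, rfl⟩ := Ideal.mem_span_singleton.1 hd
  refine (Submodule.Quotient.mk_eq_zero _).2 ⟨Ideal.Quotient.mk I (c * d * m), ?_⟩
  change Ideal.Quotient.mk I (y * (c * d * m)) = Ideal.Quotient.mk I ((b + z ^ n * d) * m)
  rw [Ideal.Quotient.eq]
  have h5 : y * (c * d * m) - (b + z ^ n * d) * m = -((z ^ n - c * y) * (d * m) + b * m) := by ring
  rw [h5]
  exact neg_mem (add_mem (Ideal.mul_mem_right _ _ hc) (Ideal.mul_mem_right _ _ hb))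

/-- The sequence `A/z → A/u → A/x` for `u = x z`. -/
def productSequence {x z u : A} (h : x * z = u) : ShortComplex (ModuleCat.{u} A) where
  X₁ := ModuleCat.of A (A ⧸ Ideal.span {z})
  X₂ := ModuleCat.of A (A ⧸ Ideal.span {u})
  X₃ := ModuleCat.of A (A ⧸ Ideal.span {x})
  f := ModuleCat.ofHom (Submodule.mapQ (Ideal.span {z}) (Ideal.span {u}) (LinearMap.mulLeft A x)
    (by
      rw [Ideal.span_singleton_le_iff_mem]
      exact h ▸ Ideal.mem_span_singleton_self (x * z)))
  g := ModuleCat.ofHom (Submodule.mapQ (Ideal.span {u}) (Ideal.span {x}) LinearMap.id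
    (by
      rw [Ideal.span_singleton_le_iff_mem]
      exact Ideal.mem_span_singleton.2 ⟨z, h.symm⟩))
  zero := by
    apply ModuleCat.hom_ext
    refine Submodule.linearMap_qext _ (LinearMap.ext fun a => ?_)
    exact (Submodule.Quotient.mk_eq_zero (Ideal.span {x})).2 (Ideal.mem_span_singleton.2 ⟨a, rfl⟩)

lemma productSequence_shortExact {x z u : A} (h : x * z = u) (hx : x ∈ nonZeroDivisors A) :
    (productSequence h).ShortExact := by
  refine ShortComplex.ShortExact.mk' ?_ ?_ ?_
  · rw [ShortComplex.moduleCat_exact_iff]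
    intro a ha
    obtain ⟨a, rfl⟩ := Submodule.mkQ_surjective (Ideal.span {u}) a
    obtain ⟨b, rfl⟩ := Ideal.mem_span_singleton.1
      ((Submodule.Quotient.mk_eq_zero (Ideal.span {x})).1 ha)
    exact ⟨Submodule.mkQ (Ideal.span {z}) b, rfl⟩
  · rw [ModuleCat.mono_iff_injective]
    refine (injective_iff_map_eq_zero (productSequence h).f.hom).2 fun a ha => ?_
    obtain ⟨a, rfl⟩ := Submodule.mkQ_surjective (Ideal.span {z}) a
    obtain ⟨b, hb⟩ := Ideal.mem_span_singleton.1
      ((Submodule.Quotient.mk_eq_zero (Ideal.span {u})).1 ha)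
    refine (Submodule.Quotient.mk_eq_zero (Ideal.span {z})).2 (Ideal.mem_span_singleton.2 ⟨b, ?_⟩)
    have hb' : x * a = x * (z * b) := by rw [← mul_assoc, h]; exact hb
    exact (mul_cancel_left_mem_nonZeroDivisors hx).1 hb'
  · rw [ModuleCat.epi_iff_surjective]
    intro a
    obtain ⟨a, rfl⟩ := Submodule.mkQ_surjective (Ideal.span {x}) a
    exact ⟨Submodule.mkQ (Ideal.span {u}) a, rfl⟩

end TwoDimensional

/-! ### The obstruction in p-torsion of H^2 -/

section Obstruction

variable {A : Type} [CommRing A] {I : Ideal A} {p : ℕ}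

/-- If `p` is not associated to `H^2_I(A)`, if `H^1_I(A) = 0` and `H^0_I(A/p) = 0`, and if `x` is
regular on `A/p`, then `H^0_I(A/(p, x)) = 0`. -/
lemma LocalCohomologyVanishes.of_notMem_associatedPrimes (hp : p.Prime)
    (hpA : (p : A) ∈ nonZeroDivisors A)
    (hass : Ideal.span {(p : ℤ)} ∉
      associatedPrimes ℤ ((localCohomology I 2).obj (ModuleCat.of A A)))
    (h₁ : LocalCohomologyVanishes I (ModuleCat.of A A) 1)
    (h₀ : LocalCohomologyVanishes I (ModuleCat.of A (A ⧸ Ideal.span {(p : A)})) 0) {x : A}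
    (hx : ∀ m : A ⧸ Ideal.span {(p : A)}, x • m = 0 → m = 0) :
    LocalCohomologyVanishes I
      (smulSequence x (ModuleCat.of A (A ⧸ Ideal.span {(p : A)}))).X₃ 0 := by
  intro t c
  have hS := smulSequence_shortExact (N := ModuleCat.of A (A ⧸ Ideal.span {(p : A)})) hx
  have hM := multiplicationSequence_shortExact hpA
  -- Both connecting maps H^0(A/(p, x)) → H^1(A/p) → H^2(A) are injective by `h₀` and `h₁`, and the
  -- image of the second is killed by `p`.
  refine eventuallyZero_of_delta hS h₀ c ?_
  refine eventuallyZero_of_delta hM h₁ _ ?_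
  refine eventuallyZero_of_smul_prime hp hass _ ?_
  exact extPush_extDelta hM 1 _ _

/-- If `I` is contained in the annihilator of a nonzero element of `N`, then `H^0_I(N) ≠ 0`. -/
lemma not_localCohomologyVanishes_zero {A : Type u} [CommRing A] {I : Ideal A} {N : ModuleCat.{u} A}
    (e : N) (he : e ≠ 0) (hI : ∀ a ∈ I, a • e = 0) : ¬ LocalCohomologyVanishes I N 0 := by
  intro h
  have hle : I ^ 1 ≤ LinearMap.ker (LinearMap.toSpanSingleton A N e) := fun a ha =>
    hI a (by rwa [pow_one] at ha)
  let φ : quotPow I 1 ⟶ N := ModuleCat.ofHom (Submodule.liftQ (I ^ 1) _ hle)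
  obtain ⟨s, hs, h0⟩ := h 1 (homToExt φ)
  rw [extPull_homToExt, ← homToExt_zero] at h0
  have h1 := congrArg (fun f => f.hom (Submodule.mkQ (I ^ s) (1 : A)))
    ((homToExt_bijective _ _).1 h0)
  refine he ?_
  rw [← one_smul A e]
  exact h1

end Obstruction

/-! ### Primes and ideals in ℤ[X, Y], its quotient and T -/

section Rings

open MvPolynomial

variable (p : ℕ)

/-- The ideal `(X_k, p)` of `ℤ[X, Y]`, as the inverse image of `(X_k)` in `𝔽_p[X, Y]`. -/
def axisIdeal (k : Fin 2) : Ideal PolyXY :=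
  (Ideal.span {(X k : MvPolynomial (Fin 2) (ZMod p))}).comap (map (Int.castRingHom (ZMod p)))

lemma natCast_eq_C : (p : PolyXY) = C (p : ℤ) := by simp

lemma X_mem_axisIdeal (k : Fin 2) : (X k : PolyXY) ∈ axisIdeal p k := by
  rw [axisIdeal, Ideal.mem_comap, map_X]
  exact Ideal.mem_span_singleton_self _

lemma mem_axisIdeal_iff {k : Fin 2} {g : PolyXY} :
    g ∈ axisIdeal p k ↔ ∃ a b : PolyXY, g = X k * a + (p : PolyXY) * b := by
  constructor
  · intro hg
    obtain ⟨h, hh⟩ := Ideal.mem_span_singleton.1 hg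
    obtain ⟨a, rfl⟩ := map_surjective (Int.castRingHom (ZMod p)) ZMod.intCast_surjective h
    have : C (p : ℤ) ∣ g - X k * a := by
      rw [C_dvd_iff_zmod, map_sub, map_mul, map_X, hh, sub_self]
    obtain ⟨b, hb⟩ := this
    exact ⟨a, b, by rw [natCast_eq_C, ← hb]; ring⟩
  · rintro ⟨a, b, rfl⟩
    refine add_mem (Ideal.mul_mem_right _ _ (X_mem_axisIdeal p k)) (Ideal.mul_mem_right _ _ ?_)
    rw [axisIdeal, Ideal.mem_comap, map_natCast, CharP.cast_eq_zero]
    exact zero_mem _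

lemma mk_mul_mk : Ideal.Quotient.mk (Ideal.span {xySubP p}) (X 0) *
    Ideal.Quotient.mk (Ideal.span {xySubP p}) (X 1) = (p : QuotXY p) := by
  rw [← map_mul, ← map_natCast (Ideal.Quotient.mk (Ideal.span {xySubP p})) p, Ideal.Quotient.eq]
  exact Ideal.mem_span_singleton_self _

lemma mk_dvd_natCast (k : Fin 2) :
    Ideal.Quotient.mk (Ideal.span {xySubP p}) (X k) ∣ (p : QuotXY p) := by
  fin_cases k
  · exact Dvd.intro _ (mk_mul_mk p)
  · exact Dvd.intro_left _ (mk_mul_mk p)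

lemma span_mk_le_idealXY (k : Fin 2) :
    Ideal.span {Ideal.Quotient.mk (Ideal.span {xySubP p}) (X k)} ≤ idealXY p := by
  rw [Ideal.span_singleton_le_iff_mem]
  exact Ideal.subset_span (by fin_cases k <;> simp)

lemma xySubP_mem_axisIdeal (k : Fin 2) : xySubP p ∈ axisIdeal p k := by
  rw [mem_axisIdeal_iff]
  fin_cases k
  · exact ⟨X 1, -1, by change X 0 * X 1 - (p : PolyXY) = X 0 * X 1 + (p : PolyXY) * -1; ring⟩
  · exact ⟨X 0, -1, by change X 0 * X 1 - (p : PolyXY) = X 1 * X 0 + (p : PolyXY) * -1; ring⟩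

/-- The generator `p` becomes redundant: it is a multiple of X_k in the quotient. -/
lemma map_axisIdeal (k : Fin 2) : (axisIdeal p k).map (Ideal.Quotient.mk (Ideal.span {xySubP p})) =
    Ideal.span {Ideal.Quotient.mk (Ideal.span {xySubP p}) (X k)} := by
  apply le_antisymm
  · rw [Ideal.map_le_iff_le_comap]
    intro g hg
    obtain ⟨a, b, rfl⟩ := (mem_axisIdeal_iff p).1 hg
    rw [Ideal.mem_comap, map_add, map_mul, map_mul, map_natCast, Ideal.mem_span_singleton]
    exact dvd_add (dvd_mul_right _ _) ((mk_dvd_natCast p k).mul_right _)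
  · rw [Ideal.span_singleton_le_iff_mem]
    exact Ideal.mem_map_of_mem _ (X_mem_axisIdeal p k)

lemma ker_mk_le_axisIdeal (k : Fin 2) :
    RingHom.ker (Ideal.Quotient.mk (Ideal.span {xySubP p})) ≤ axisIdeal p k := by
  rw [Ideal.mk_ker, Ideal.span_singleton_le_iff_mem]
  exact xySubP_mem_axisIdeal p k

variable [hp : Fact p.Prime]

instance (k : Fin 2) : (axisIdeal p k).IsPrime := by
  have : (Ideal.span {(X k : MvPolynomial (Fin 2) (ZMod p))}).IsPrime :=
    (Ideal.span_singleton_prime (X_prime (i := k)).ne_zero).2 X_prime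
  exact Ideal.IsPrime.comap _

instance (k : Fin 2) :
    (Ideal.span {Ideal.Quotient.mk (Ideal.span {xySubP p}) (X k)}).IsPrime := by
  rw [← map_axisIdeal]
  exact Ideal.map_isPrime_of_surjective Ideal.Quotient.mk_surjective (ker_mk_le_axisIdeal p k)

lemma span_toLocXY (k : Fin 2) : Ideal.span {toLocXY p (X k)} =
    (Ideal.span {Ideal.Quotient.mk (Ideal.span {xySubP p}) (X k)}).map
      (algebraMap (QuotXY p) (LocXY p)) := by
  rw [Ideal.map_span, Set.image_singleton]
  rfl

instance (k : Fin 2) : (Ideal.span {toLocXY p (X k)}).IsPrime := by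
  rw [span_toLocXY]
  exact Ideal.isPrime_map_of_isLocalizationAtPrime (idealXY p) (span_mk_le_idealXY p k)

/-- A prime below the localizing prime is recovered by contraction, and `axisIdeal p k` contains XY
- p. This turns containments in T into containments in ℤ[X, Y]. -/
lemma comap_span_toLocXY (k : Fin 2) :
    (Ideal.span {toLocXY p (X k)}).comap (toLocXY p) = axisIdeal p k := by
  rw [span_toLocXY, toLocXY, ← Ideal.comap_comap]
  have := Ideal.under_map_of_isLocalizationAtPrime (idealXY p) (S := LocXY p)
    (span_mk_le_idealXY p k)
  rw [Ideal.under] at this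
  rw [this, ← map_axisIdeal, Ideal.comap_map_of_surjective _ Ideal.Quotient.mk_surjective,
    ← RingHom.ker_eq_comap_bot, sup_eq_left]
  exact ker_mk_le_axisIdeal p k

lemma toLocXY_mul_toLocXY : toLocXY p (X 0) * toLocXY p (X 1) = (p : LocXY p) := by
  have := congrArg (algebraMap (QuotXY p) (LocXY p)) (mk_mul_mk p)
  rwa [map_mul, map_natCast] at this

lemma toLocXY_xySubP : toLocXY p (xySubP p) = 0 := by
  rw [xySubP, map_sub, map_mul, toLocXY_mul_toLocXY, map_natCast, sub_self]

instance : IsNoetherianRing (LocXY p) :=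
  IsLocalization.isNoetherianRing (idealXY p).primeCompl (LocXY p) inferInstance

instance : IsLocalRing (LocXY p) := IsLocalization.AtPrime.isLocalRing (LocXY p) (idealXY p)

lemma maximalIdeal_locXY : IsLocalRing.maximalIdeal (LocXY p) =
    Ideal.span {toLocXY p (X 0)} ⊔ Ideal.span {toLocXY p (X 1)} := by
  rw [← IsLocalization.AtPrime.map_eq_maximalIdeal (idealXY p) (LocXY p), idealXY, Ideal.map_span,
    Set.image_pair, Ideal.span_insert]
  rfl

lemma prime_natCast_polyXY : Prime (p : PolyXY) := by
  rw [natCast_eq_C]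
  exact (prime_C_iff _).2 (Nat.prime_iff_prime_int.1 hp.out)

lemma not_natCast_dvd_X (k : Fin 2) : ¬ (p : PolyXY) ∣ X k := by
  rw [natCast_eq_C, C_dvd_iff_zmod, map_X]
  exact (X_prime (i := k)).ne_zero

lemma not_natCast_dvd_xySubP : ¬ (p : PolyXY) ∣ xySubP p := by
  intro h
  have h1 : (p : PolyXY) ∣ X 0 * X 1 := by
    rw [xySubP] at h
    exact (dvd_sub_self_right).1 h
  exact ((prime_natCast_polyXY p).dvd_or_dvd h1).elim (not_natCast_dvd_X p 0)
    (not_natCast_dvd_X p 1)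

/-- As a polynomial in X it is linear with coefficients Y and -p, which are relatively prime because
the prime Y does not divide a nonzero constant. Irreducibles are prime in the factorial ring ℤ[X,
Y]. -/
lemma prime_xySubP : Prime (xySubP p) := by
  have hirr : Irreducible ((X 1 : PolyXY) * X 0 + C (-(p : ℤ))) := by
    refine irreducible_mul_X_add _ _ 0 (X_ne_zero 1) (by simp [vars_X])
      (by rw [vars_C]; exact Finset.notMem_empty _) ?_
    refine ((X_prime (R := ℤ) (i := (1 : Fin 2))).irreducible.isRelPrime_iff_not_dvd).2 ?_
    rintro ⟨h, hh⟩
    have := congrArg constantCoeff hh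
    rw [constantCoeff_C, map_mul, constantCoeff_X, zero_mul, neg_eq_zero] at this
    exact hp.out.ne_zero (by exact_mod_cast this)
  have : xySubP p = X 1 * X 0 + C (-(p : ℤ)) := by
    rw [xySubP, natCast_eq_C, map_neg]; ring
  rw [this]
  exact hirr.prime

end Rings

/-! ### Excluding the mixed case -/

section Main

open MvPolynomial

variable {p : ℕ} [hp : Fact p.Prime]

/-- The vanishing of `H^1_I(ℤ[X, Y])` for an ideal strictly containing `XY - p`. -/
lemma localCohomologyVanishes_polyXY {I : Ideal PolyXY} (hf : xySubP p ∈ I) {g : PolyXY}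
    (hg : g ∈ I) (hgf : ¬ xySubP p ∣ g) :
    LocalCohomologyVanishes I (ModuleCat.of PolyXY PolyXY) 1 := by
  have hreg : ∀ a : PolyXY, xySubP p • a = 0 → a = 0 := fun a ha =>
    (mul_eq_zero.1 ha).resolve_left (prime_xySubP p).ne_zero
  -- XY - p, g is a regular sequence in `I`: the first is prime and does not divide the second.
  refine .succ_of_smul hf hreg (.zero_of_smul_injective hg fun m hm => ?_)
  obtain ⟨m, rfl⟩ := Submodule.mkQ_surjective _ m
  obtain ⟨a, ha⟩ := (Submodule.Quotient.mk_eq_zero _).1 hm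
  have ha' : xySubP p * a = g * m := ha
  obtain ⟨b, hb⟩ := ((prime_xySubP p).dvd_or_dvd (Dvd.intro _ ha')).resolve_left hgf
  exact (Submodule.Quotient.mk_eq_zero _).2 ⟨b, hb.symm⟩

lemma smul_polyXY_quotient_eq_zero {g : PolyXY} (hg : ¬ (p : PolyXY) ∣ g)
    (m : PolyXY ⧸ Ideal.span {(p : PolyXY)}) (hm : g • m = 0) : m = 0 := by
  have : (Ideal.span {(p : PolyXY)}).IsPrime :=
    (Ideal.span_singleton_prime (prime_natCast_polyXY p).ne_zero).2 (prime_natCast_polyXY p)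
  exact smul_quotient_eq_zero (fun h => hg (Ideal.mem_span_singleton.1 h)) m hm

/-- If `p` is not associated to `H^2_I(ℤ[X, Y])`, where `I` strictly contains `XY - p`, then `I` is
not contained in `(X_k, p)`. -/
lemma not_le_axisIdeal {I : Ideal PolyXY} (hf : xySubP p ∈ I) {g : PolyXY}
    (hg : g ∈ I) (hgf : ¬ xySubP p ∣ g)
    (hass : Ideal.span {(p : ℤ)} ∉
      associatedPrimes ℤ ((localCohomology I 2).obj (ModuleCat.of PolyXY PolyXY))) (k : Fin 2) :
    ¬ I ≤ axisIdeal p k := by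
  intro hI
  have h0 : LocalCohomologyVanishes I
      (ModuleCat.of PolyXY (PolyXY ⧸ Ideal.span {(p : PolyXY)})) 0 :=
    .zero_of_smul_injective hf (smul_polyXY_quotient_eq_zero (not_natCast_dvd_xySubP p))
  have hpA : (p : PolyXY) ∈ nonZeroDivisors PolyXY :=
    mem_nonZeroDivisors_of_ne_zero (prime_natCast_polyXY p).ne_zero
  have hvan := LocalCohomologyVanishes.of_notMem_associatedPrimes hp.out hpA hass
    (localCohomologyVanishes_polyXY hf hg hgf) h0
    (smul_polyXY_quotient_eq_zero (not_natCast_dvd_X p k))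
  refine not_localCohomologyVanishes_zero (N := (smulSequence (X k : PolyXY)
    (ModuleCat.of PolyXY (PolyXY ⧸ Ideal.span {(p : PolyXY)}))).X₃)
    (Submodule.Quotient.mk (Submodule.Quotient.mk 1)) ?_ ?_ hvan
  · intro h
    obtain ⟨b, hb⟩ := (Submodule.Quotient.mk_eq_zero _).1 h
    obtain ⟨b, rfl⟩ := Submodule.mkQ_surjective _ b
    obtain ⟨c, hc⟩ := Ideal.mem_span_singleton.1
      ((Submodule.Quotient.eq (Ideal.span {(p : PolyXY)})).1 hb)
    have hprime : (axisIdeal p k).IsPrime := inferInstance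
    refine hprime.ne_top ((Ideal.eq_top_iff_one _).2 ?_)
    rw [mem_axisIdeal_iff]
    have hc' : X k * b - 1 = (p : PolyXY) * c := hc
    exact ⟨b, -c, by linear_combination -hc'⟩
  · intro a ha
    obtain ⟨b, c, rfl⟩ := (mem_axisIdeal_iff p).1 (hI ha)
    refine (Submodule.Quotient.mk_eq_zero _).2 ⟨Submodule.Quotient.mk b, ?_⟩
    refine (Submodule.Quotient.eq (Ideal.span {(p : PolyXY)})).2 ?_
    change X k * b - (X k * b + (p : PolyXY) * c) * 1 ∈ _
    rw [Ideal.mem_span_singleton]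
    exact ⟨-c, by ring⟩

end Main

end

theorem theorem5p1 (p : ℕ) [Fact p.Prime] (J : Ideal (LocXY p)) (I : Ideal PolyXY)
    (hI : I = J.comap (toLocXY p)) (i : ℕ)
    (hp : Ideal.span {(p : ℤ)} ∉
      associatedPrimes ℤ ((localCohomology I i).obj (ModuleCat.of PolyXY PolyXY)) ∪
        associatedPrimes ℤ ((localCohomology I (i + 1)).obj (ModuleCat.of PolyXY PolyXY))) :
    bockstein (I.map (toLocXY p))
      (natCast_mem_nonZeroDivisors_locXY p) i = 0 := by
  set J' := I.map (toLocXY p) with hJ'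
  have hprod := productSequence_shortExact (toLocXY_mul_toLocXY p)
    (mem_nonZeroDivisors_iff_right.2 fun a ha => by
      refine (mem_nonZeroDivisors_iff_right.1 (natCast_mem_nonZeroDivisors_locXY p)) a ?_
      rw [← toLocXY_mul_toLocXY, ← mul_assoc, ha, zero_mul])
  have hmem : ∀ k, toLocXY p (MvPolynomial.X k) ∈ IsLocalRing.maximalIdeal (LocXY p) := by
    intro k
    rw [maximalIdeal_locXY]
    fin_cases k
    · exact Ideal.mem_sup_left (Ideal.mem_span_singleton_self _)
    · exact Ideal.mem_sup_right (Ideal.mem_span_singleton_self _)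
  match i, hp with
  -- In degree zero `bockstein` is the zero map by definition.
  | 0, _ => rfl
  | n + 2, _ =>
    refine bockstein_succ_eq_zero_of_target _ (.middle hprod ?_ ?_)
    · exact .quotient_add_two (z := toLocXY p (MvPolynomial.X 0))
        (by rw [maximalIdeal_locXY, sup_comm]) (hmem 0) n
    · exact .quotient_add_two (z := toLocXY p (MvPolynomial.X 1)) (by rw [maximalIdeal_locXY]) (hmem 1) n
  | 1, hp =>
    have hass : Ideal.span {(p : ℤ)} ∉
        associatedPrimes ℤ ((localCohomology I 2).obj (ModuleCat.of PolyXY PolyXY)) :=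
      fun h => hp (Or.inr h)
    have hf : xySubP p ∈ I := by
      rw [hI, Ideal.mem_comap, toLocXY_xySubP]
      exact zero_mem _
    have hle : ∀ k, J' ≤ Ideal.span {toLocXY p (MvPolynomial.X k)} → I ≤ axisIdeal p k := by
      intro k h
      rw [← comap_span_toLocXY]
      exact Ideal.map_le_iff_le_comap.1 h
    -- An element of `I` whose image avoids (x_j) is not a multiple of XY - p, which maps to 0. So
    -- `I` is strictly larger than (XY - p) and `not_le_axisIdeal` applies.
    have hkey : ∀ j k, ¬ J' ≤ Ideal.span {toLocXY p (MvPolynomial.X j)} →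
        ¬ J' ≤ Ideal.span {toLocXY p (MvPolynomial.X k)} := by
      intro j k hj hk
      rw [hJ', Ideal.map_le_iff_le_comap] at hj
      obtain ⟨g, hg, hgj⟩ := Set.not_subset.1 hj
      refine not_le_axisIdeal hf hg ?_ hass k (hle k hk)
      rintro ⟨a, rfl⟩
      refine hgj ?_
      rw [SetLike.mem_coe, Ideal.mem_comap, map_mul, toLocXY_xySubP, zero_mul]
      exact zero_mem _
    by_cases h0 : J' ≤ Ideal.span {toLocXY p (MvPolynomial.X 0)}
    · have h1 : J' ≤ Ideal.span {toLocXY p (MvPolynomial.X 1)} := by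
        by_contra h1
        exact hkey 1 0 h1 h0
      exact bockstein_succ_eq_zero_of_target _
        (.middle hprod (.quotient_of_le h1 0) (.quotient_of_le h0 0))
    · exact bockstein_succ_eq_zero_of_source _
        (.middle hprod (.quotient_of_not_le (hkey 0 1 h0)) (.quotient_of_not_le h0))
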